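/- Let $a_1<a_2$ be non-negative integers, let $\Omega=[a_1,a_1+1)\cup[a_2,a_2+1)$, and let $N\ge 1$ be an integer. For $x\in\Omega$ put $a(x)=a_2$ if $x\in[a_1,a_1+1)$ and $a(x)=a_1$ if $x\in[a_2,a_2+1)$. Define $T:\Omega\to\Omega$ by $T(x)=\frac Nx-\left\lfloor\frac Nx\right\rfloor+a(x)$ for $x\ne0$, and $T(0)=0$ if $0\in\Omega$. Let $d_1(x)=\left\lfloor\frac Nx\right\rfloor-a(x)$ for $x\neq 0$, and $d_n(x)=d_1(T^{n-1}(x))$. Assume that the system is simple, i.e. $d_1(x)>0$ for all $x\in\Omega\setminus\{0\}$, and every nonzero element of $\{a_1,a_1+1,a_2,a_2+1\}$ divides $N$. Let $p_n,q_n$ be given by $$p_{-1}=1,\quad p_0=0,\quad p_n=d_np_{n-1}+Np_{n-2},\qquad q_{-1}=0,\quad q_0=1,\quad q_n=d_nq_{n-1}+Nq_{n-2},$$ and let $\theta_n(x)=\frac{q_n^2}{N^n}\left|x-\frac{p_n}{q_n}\right|$. (For all but countably many $x\in\Omega$ the orbit of $x$ avoids $0$, so that these are defined for all $n$.) Let $$X=[a_1,a_1+1)\times[a_2,a_2+1]\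 \cup\ [a_2,a_2+1)\times[a_1,a_1+1],$$ let $\bar\mu$ be the measure $\bar\mu(A)=C\iint_A\frac{N}{(N+xy)^2}\,dy\,dx$ on $X$ with normalizing constant $C^{-1}=\iint_X\frac{N}{(N+xy)^2}\,dy\,dx$, and for $c\in\mathbb R$ let $A_c=\{(x,y)\in X:\frac{Nx}{N+xy}\le c\}$ and $F(c)=\bar\mu(A_c)$. Then $\bar\mu$ is a probability measure, with $$C^{-1}=2\log\left(1+\frac{N}{(N+a_1(a_2+1))(N+a_2(a_1+1))}\right),$$ and for Lebesgue-almost every $x\in\Omega$ one has, for all $c\in\mathbb R$, $$\lim_{n\to\infty}\frac1n\#\{1\le i\le n:\theta_i(x)\le c\}=F(c).$$ Moreover $$F(c)=\begin{cases} 0 & c\in\left(-\infty,\frac{Na_1}{N+a_1(a_2+1)}\right]\\ C\left(\frac{c(a_2+1+\frac N{a_1})}{N}-1-\log\left(\frac{Nc+ca_1(a_2+1)}{a_1N}\right)\right) & c\in\left(\frac{Na_1}{N+a_1(a_2+1)},\frac{Na_1}{N+a_1a_2}\right]\\ C\left(-\log\left(\frac{N+a_1(a_2+1)}{N+a_1a_2}\right)+\frac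 cN\right) & c\in\left(\frac{Na_1}{N+a_1a_2},\frac{N(a_1+1)}{N+(a_1+1)(a_2+1)}\right]\\ C\left(\log\left(\frac{Nc+c(a_1+1)(a_2+1)}{N(a_1+1)}\cdot\frac{N+a_1a_2}{N+a_1(a_2+1)}\right)+1-\frac c{a_1+1}-\frac{ca_2}N\right) & c\in\left(\frac{N(a_1+1)}{N+(a_1+1)(a_2+1)},\frac{N(a_1+1)}{N+a_2(a_1+1)}\right]\\ \frac12 & c\in\left(\frac{N(a_1+1)}{N+a_2(a_1+1)},\frac{Na_2}{N+a_2(a_1+1)}\right]\\ \frac12+C\left(\frac{c(a_1+1+\frac N{a_2})}{N}-1-\log\left(\frac{Nc+ca_2(a_1+1)}{a_2N}\right)\right) & c\in\left(\frac{Na_2}{N+a_2(a_1+1)},\frac{Na_2}{N+a_1a_2}\right]\\ \frac12+C\left(-\log\left(\frac{N+a_2(a_1+1)}{N+a_1a_2}\right)+\frac cN\right) & c\in\left(\frac{Na_2}{N+a_1a_2},\frac{N(a_2+1)}{N+(a_1+1)(a_2+1)}\right]\\ \frac12+C\left(\log\left(\frac{Nc+c(a_2+1)(a_1+1)}{N(a_2+1)}\cdot\frac{N+a_1a_2}{N+a_2(a_1+1)}\right)+1-\frac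 c{a_2+1}-\frac{ca_1}N\right) & c\in\left(\frac{N(a_2+1)}{N+(a_1+1)(a_2+1)},\frac{N(a_2+1)}{N+a_1(a_2+1)}\right]\\ 1 & c\in\left(\frac{N(a_2+1)}{N+a_1(a_2+1)},\infty\right). \end{cases}$$ (Some of these intervals may be empty; the second one is when $a_1=0$.) -/

import Mathlib

open Filter Topology MeasureTheory

noncomputable section

namespace AltNCF

/-- The interval `[a, a+1)`. -/
def I (a : ℕ) : Set ℝ := Set.Ico (a : ℝ) (a + 1)

/-- `Ω = [a₁, a₁+1) ∪ [a₂, a₂+1)`. -/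
def Omega (a₁ a₂ : ℕ) : Set ℝ := I a₁ ∪ I a₂

/-- The left end point `a_{k(x)}` of the interval which follows, cyclically, the one that
contains `x`: it is `a₂` for `x ∈ [a₁, a₁+1)` and `a₁` for `x ∈ [a₂, a₂+1)`. -/
def nextEnd (a₁ a₂ : ℕ) (x : ℝ) : ℕ :=
  open Classical in if x ∈ I a₁ then a₂ else a₁

/-- The first digit `d₁(x) = ⌊N / x⌋ - a_{k(x)}`. -/
def digit (a₁ a₂ N : ℕ) (x : ℝ) : ℤ := ⌊(N : ℝ) / x⌋ - (nextEnd a₁ a₂ x : ℤ)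

/-- The alternating `N`-continued fraction map
`T x = N / x - ⌊N / x⌋ + a_{k(x)}` for `x ≠ 0`, and `T 0 = 0`. -/
def T (a₁ a₂ N : ℕ) (x : ℝ) : ℝ :=
  if x = 0 then 0 else (N : ℝ) / x - (⌊(N : ℝ) / x⌋ : ℝ) + (nextEnd a₁ a₂ x : ℝ)

/-- `(N, N)` is allowable for `Ω`: all digits are positive (at `x = 0` no digit is defined). -/
def IsAllowable (a₁ a₂ N : ℕ) : Prop :=
  ∀ x ∈ Omega a₁ a₂, x ≠ 0 → 0 < digit a₁ a₂ N x

/-- `(N, N)` is simple for `Ω`, that is, desirable with equal numerators: it is allowable, and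
every nonzero end point of the two intervals divides `N`. -/
def IsSimple (a₁ a₂ N : ℕ) : Prop :=
  0 < N ∧ IsAllowable a₁ a₂ N ∧
    (a₁ ≠ 0 → a₁ ∣ N) ∧ a₁ + 1 ∣ N ∧ (a₂ ≠ 0 → a₂ ∣ N) ∧ a₂ + 1 ∣ N

/-- The `n`-th digit `dₙ(x) = d₁(T^{n-1} x)`, for `n ≥ 1`. -/
def d (a₁ a₂ N : ℕ) (x : ℝ) (n : ℕ) : ℤ := digit a₁ a₂ N ((T a₁ a₂ N)^[n - 1] x)

/-- Numerators of the convergents, `pₙ = dₙ pₙ₋₁ + N pₙ₋₂` with `p₋₁ = 1`, `p₀ = 0`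
(so `p₁ = d₁ * 0 + N * 1`). -/
def p (a₁ a₂ N : ℕ) (x : ℝ) : ℕ → ℤ
  | 0 => 0
  | 1 => N
  | n + 2 => d a₁ a₂ N x (n + 2) * p a₁ a₂ N x (n + 1) + N * p a₁ a₂ N x n

/-- Denominators of the convergents, `qₙ = dₙ qₙ₋₁ + N qₙ₋₂` with `q₋₁ = 0`, `q₀ = 1`
(so `q₁ = d₁ * 1 + N * 0`). -/
def q (a₁ a₂ N : ℕ) (x : ℝ) : ℕ → ℤ
  | 0 => 1
  | 1 => d a₁ a₂ N x 1
  | n + 2 => d a₁ a₂ N x (n + 2) * q a₁ a₂ N x (n + 1) + N * q a₁ a₂ N x n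

/-- The approximation coefficient `θₙ(x) = qₙ² / (N₁ ⋯ Nₙ) * |x - pₙ / qₙ|`, where all
numerators `Nᵢ` equal `N`. -/
def theta (a₁ a₂ N : ℕ) (n : ℕ) (x : ℝ) : ℝ :=
  (q a₁ a₂ N x n : ℝ) ^ 2 / (∏ _i ∈ Finset.Icc 1 n, (N : ℝ)) *
    |x - (p a₁ a₂ N x n : ℝ) / (q a₁ a₂ N x n : ℝ)|

/-- The domain of the natural extension,
`X = [a₁, a₁+1) × [a₂, a₂+1] ∪ [a₂, a₂+1) × [a₁, a₁+1]`. -/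
def X (a₁ a₂ : ℕ) : Set (ℝ × ℝ) :=
  I a₁ ×ˢ Set.Icc (a₂ : ℝ) (a₂ + 1) ∪ I a₂ ×ˢ Set.Icc (a₁ : ℝ) (a₁ + 1)

/-- The unnormalised density `N / (N + x y)²`. -/
def density (N : ℕ) (z : ℝ × ℝ) : ℝ := (N : ℝ) / ((N : ℝ) + z.1 * z.2) ^ 2

/-- The normalising constant `C`, `C⁻¹ = ∬_X N / (N + x y)²`. -/
def C (a₁ a₂ N : ℕ) : ℝ := (∫ z in X a₁ a₂, density N z)⁻¹

/-- The measure `μ̄` on `X` with density `C N / (N + x y)²`. -/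
def muBar (a₁ a₂ N : ℕ) : Measure (ℝ × ℝ) :=
  (volume.restrict (X a₁ a₂)).withDensity fun z => ENNReal.ofReal (C a₁ a₂ N * density N z)

/-- `A_c = {(x, y) ∈ X : N x / (N + x y) ≤ c}`. -/
def A (a₁ a₂ N : ℕ) (c : ℝ) : Set (ℝ × ℝ) :=
  {z | z ∈ X a₁ a₂ ∧ (N : ℝ) * z.1 / ((N : ℝ) + z.1 * z.2) ≤ c}

/-- `F(c) = μ̄(A_c)`. -/
def F (a₁ a₂ N : ℕ) (c : ℝ) : ℝ := (muBar a₁ a₂ N (A a₁ a₂ N c)).toReal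

/-- The number of indices `1 ≤ i ≤ n` with `θᵢ(x) ≤ c`. -/
def count (a₁ a₂ N : ℕ) (x c : ℝ) (n : ℕ) : ℕ :=
  open Classical in ((Finset.Icc 1 n).filter fun i => theta a₁ a₂ N i x ≤ c).card

end AltNCF

end

/-!
The approximation coefficients are read off the natural extension
`S(x, y) = (T x, N / (d₁(x) + y))`. If `tₙ = Tⁿ x` and `vₙ = qₙ₋₁ / qₙ`, then
`θₙ(x) = N tₙ / (N + tₙ · N vₙ)`, and `(tₙ, N vₙ) = Sⁿ(x, 0)` (`theta_eq`). So the question is how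
the orbits of `S` are distributed with respect to the function `N x / (N + x y)`, and the answer is
given by the `S`-invariant measure `μ̄`.

*Invariance.* As the end points of the intervals divide `N`, all branches of `T` are full. On the
points of `X` with irrational coordinates `S` is a bijection, with inverse `swap ∘ S ∘ swap`, and
it is differentiable there; the change of variables formula, used once, shows that `μ̄` is
`S`-invariant (`measurePreserving_natExt`). Its first marginal is then `T`-invariant.

*Ergodicity of `T`.* The inverse branches of `Tⁿ` are Möbius maps given by the convergents. They
have bounded distortion and their ranges shrink to a point, so an invariant set of positive measure
has lower density bounded below at every irrational point. Lebesgue's density theorem shows that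
its complement is null (`ergodic_T`).

*Equidistribution.* Ergodicity of `S` is not needed. The second coordinate forgets its initial
value exponentially fast, so up to a small error `θₙ₊₂ₘ(x)` is a function of `Tⁿ x` only, to which
the pointwise ergodic theorem for `T` applies; the integrals that come out are `F(c)` up to the same
error, by the invariance of `μ̄`. As `F` is continuous the errors can be removed
(`ae_tendsto_count`). The pointwise ergodic theorem is proved from a maximal inequality.

*The distribution function.* On a vertical segment the density has the primitive `y / (N + x y)`,
and the segment is cut by `N x / (N + x y) ≤ c` fully, partially or not at all, according to the
position of `x` relative to `N c / (N - b c)` and `N c / (N - (b + 1) c)`. Integrating over `x`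
gives a mass for each of the two rectangles (`stripMass_eq`), and the cases of the formula list
where the two thresholds lie relative to the end points of the intervals.
-/

noncomputable section

/-! ### The pointwise ergodic theorem -/

section PointwiseErgodic

variable {α : Type*} {τ : α → α} {f : α → ℝ}

/-- The maximum of the Birkhoff sums of `f` over `1, …, n + 1` steps. -/
def maxBirkhoffSum (τ : α → α) (f : α → ℝ) : ℕ → α → ℝ
  | 0 => f
  | n + 1 => fun x => f x + max 0 (maxBirkhoffSum τ f n (τ x))

lemma maxBirkhoffSum_succ (n : ℕ) (x : α) :
    maxBirkhoffSum τ f (n + 1) x = f x + max 0 (maxBirkhoffSum τ f n (τ x)) := rfl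

lemma birkhoffSum_le_maxBirkhoffSum (n k : ℕ) (hk : k ≤ n) (x : α) :
    birkhoffSum τ f (k + 1) x ≤ maxBirkhoffSum τ f n x := by
  induction n generalizing k x with
  | zero => obtain rfl : k = 0 := by omega
            simp [maxBirkhoffSum]
  | succ n ih =>
    rw [birkhoffSum_succ', maxBirkhoffSum_succ]
    rcases k with _ | k
    · simp
    · gcongr
      exact (ih k (by omega) (τ x)).trans (le_max_right _ _)

lemma maxBirkhoffSum_le_succ (n : ℕ) (x : α) :
    maxBirkhoffSum τ f n x ≤ maxBirkhoffSum τ f (n + 1) x := by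
  induction n generalizing x with
  | zero => simp [maxBirkhoffSum]
  | succ n ih =>
    rw [maxBirkhoffSum_succ, maxBirkhoffSum_succ]
    gcongr
    exact ih (τ x)

/-- The points at which the Birkhoff sums of `f` are unbounded above. -/
def unboundedSums (τ : α → α) (f : α → ℝ) : Set α :=
  {x | ∀ M : ℕ, ∃ n, (M : ℝ) < birkhoffSum τ f n x}

lemma preimage_unboundedSums : τ ⁻¹' unboundedSums τ f = unboundedSums τ f := by
  ext x
  simp only [unboundedSums, Set.mem_preimage, Set.mem_ofPred_eq]
  constructor
  · intro h M
    obtain ⟨M', hM'⟩ := exists_nat_gt (M - f x)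
    obtain ⟨n, hn⟩ := h M'
    refine ⟨n + 1, ?_⟩
    rw [birkhoffSum_succ']
    linarith
  · intro h M
    obtain ⟨M', hM'⟩ := exists_nat_gt (M + f x)
    obtain ⟨n, hn⟩ := h M'
    rcases n with _ | n
    · rw [birkhoffSum_zero] at hn
      exact absurd hn (not_lt.2 M'.cast_nonneg)
    · rw [birkhoffSum_succ'] at hn
      exact ⟨n, by linarith⟩

variable [MeasurableSpace α] {μ : Measure α}

lemma integrable_maxBirkhoffSum (hτ : MeasurePreserving τ μ μ) (hf : Integrable f μ) (n : ℕ) :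
    Integrable (maxBirkhoffSum τ f n) μ := by
  induction n with
  | zero => exact hf
  | succ n ih =>
    refine hf.add ?_
    exact (integrable_zero _ _ _).sup (hτ.integrable_comp_of_integrable ih)

lemma measurable_birkhoffSum (hτ : Measurable τ) (hf : Measurable f) (n : ℕ) :
    Measurable (birkhoffSum τ f n) := by
  unfold birkhoffSum
  exact Finset.measurable_sum _ fun i _ => hf.comp (hτ.iterate i)

lemma measurableSet_unboundedSums (hτ : Measurable τ) (hf : Measurable f) :
    MeasurableSet (unboundedSums τ f) := by
  have : unboundedSums τ f = ⋂ M : ℕ, ⋃ n, {x | (M : ℝ) < birkhoffSum τ f n x} := by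
    ext; simp [unboundedSums]
  rw [this]
  exact .iInter fun M => .iUnion fun n =>
    measurableSet_lt measurable_const (measurable_birkhoffSum hτ hf n)

/-- The maximal ergodic inequality, in the form needed for the pointwise theorem: the set where
the Birkhoff sums are unbounded carries a nonnegative integral. The differences
`Fₙ₊₁ - Fₙ ∘ τ` of the maximal sums have nonnegative integrals and tend to `f` there. -/
lemma setIntegral_unboundedSums_nonneg (hτ : MeasurePreserving τ μ μ) (hfm : Measurable f)
    (hf : Integrable f μ) : 0 ≤ ∫ x in unboundedSums τ f, f x ∂μ := by
  set A := unboundedSums τ f with hA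
  have hAm : MeasurableSet A := measurableSet_unboundedSums hτ.measurable hfm
  have hAτ : MeasurePreserving τ (μ.restrict A) (μ.restrict A) := by
    have := hτ.restrict_preimage hAm
    rwa [preimage_unboundedSums] at this
  have hF := fun n => (integrable_maxBirkhoffSum hτ hf n).restrict (s := A)
  have hFτ := fun n => hAτ.integrable_comp_of_integrable (hF n)
  have hlim : Tendsto (fun n => ∫ x in A, (maxBirkhoffSum τ f (n + 1) x
      - maxBirkhoffSum τ f n (τ x)) ∂μ) atTop (𝓝 (∫ x in A, f x ∂μ)) := by
    refine tendsto_integral_of_dominated_convergence (fun x => |f x| + |f (τ x)|)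
      (fun n => ((hF (n + 1)).sub (hFτ n)).aestronglyMeasurable)
      (hf.abs.restrict.add (hAτ.integrable_comp_of_integrable hf.abs.restrict)) ?_ ?_
    · intro n
      refine ae_of_all _ fun x => ?_
      have h0 : f (τ x) ≤ maxBirkhoffSum τ f n (τ x) := by
        simpa using birkhoffSum_le_maxBirkhoffSum (τ := τ) (f := f) n 0 (Nat.zero_le _) (τ x)
      rw [maxBirkhoffSum_succ, Real.norm_eq_abs, add_sub_assoc]
      refine (abs_add_le _ _).trans (add_le_add_right ?_ _)
      rcases le_total 0 (maxBirkhoffSum τ f n (τ x)) with h | h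
      · rw [max_eq_right h]; simp
      · rw [max_eq_left h, zero_sub, abs_neg, abs_of_nonpos h, abs_of_nonpos (h0.trans h)]
        linarith
    · refine (ae_restrict_iff' hAm).2 (ae_of_all _ fun x hx => ?_)
      refine tendsto_const_nhds.congr' ?_
      have hx' : τ x ∈ A := by
        rwa [← Set.mem_preimage, hA, preimage_unboundedSums]
      obtain ⟨n, hn⟩ := hx' 0
      rcases n with _ | n
      · simp at hn
      · filter_upwards [eventually_ge_atTop n] with m hm
        have := birkhoffSum_le_maxBirkhoffSum (τ := τ) (f := f) m n hm (τ x)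
        rw [maxBirkhoffSum_succ, max_eq_right]
        · ring
        · exact (Nat.cast_zero (R := ℝ) ▸ hn.le).trans this
  refine ge_of_tendsto' hlim fun n => ?_
  have hc : ∫ x in A, maxBirkhoffSum τ f n (τ x) ∂μ = ∫ x in A, maxBirkhoffSum τ f n x ∂μ := by
    have h1 := integral_map hAτ.aemeasurable (f := maxBirkhoffSum τ f n)
      (by rw [hAτ.map_eq]; exact (hF n).aestronglyMeasurable)
    rw [hAτ.map_eq] at h1
    exact h1.symm
  have hs := integral_sub (hF (n + 1)) (hFτ n)
  have hmono := integral_mono (hF n) (hF (n + 1)) (maxBirkhoffSum_le_succ n)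
  simp only [Function.comp_def] at *
  linarith

lemma ae_bounded_birkhoffSum (hτ : Ergodic τ μ) (hfm : Measurable f) (hf : Integrable f μ)
    (hneg : ∫ x, f x ∂μ < 0) : ∀ᵐ x ∂μ, ∃ M : ℕ, ∀ n, birkhoffSum τ f n x ≤ M := by
  have hpos := setIntegral_unboundedSums_nonneg hτ.toMeasurePreserving hfm hf
  rcases hτ.ae_mem_or_ae_notMem (measurableSet_unboundedSums hτ.measurable hfm)
    preimage_unboundedSums with h | h
  · rw [Measure.restrict_eq_self_of_ae_mem h] at hpos
    exact absurd hneg hpos.not_gt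
  · filter_upwards [h] with x hx
    simpa [unboundedSums] using hx

variable [IsProbabilityMeasure μ]

lemma ae_eventually_birkhoffAverage_lt (hτ : Ergodic τ μ) (hfm : Measurable f)
    (hf : Integrable f μ) :
    ∀ᵐ x ∂μ, ∀ ε > 0, ∀ᶠ n : ℕ in atTop, birkhoffAverage ℝ τ f n x < ∫ y, f y ∂μ + ε := by
  -- Subtracting slightly more than the mean makes the integral negative.
  have key : ∀ k : ℕ, ∀ᵐ x ∂μ, ∃ M : ℕ, ∀ n,
      birkhoffSum τ (fun y => f y - (∫ y, f y ∂μ + 1 / ((k : ℝ) + 1))) n x ≤ M := by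
    intro k
    refine ae_bounded_birkhoffSum hτ (hfm.sub_const _) (hf.sub (integrable_const _)) ?_
    rw [integral_sub hf (integrable_const _)]
    simp only [integral_const, probReal_univ, one_smul]
    have : 0 < 1 / ((k : ℝ) + 1) := by positivity
    linarith
  filter_upwards [ae_all_iff.2 key] with x hx ε hε
  obtain ⟨k, hk⟩ := exists_nat_one_div_lt (half_pos hε)
  obtain ⟨M, hM⟩ := hx k
  obtain ⟨n₀, hn₀⟩ := exists_nat_gt (M / (ε / 2))
  filter_upwards [eventually_ge_atTop (n₀ + 1)] with n hn
  have hnpos : (0 : ℝ) < n := by exact_mod_cast (by omega : 0 < n)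
  have h1 := hM n
  have h2 : birkhoffSum τ (fun y => f y - (∫ y, f y ∂μ + 1 / ((k : ℝ) + 1))) n x
      = birkhoffSum τ f n x - n * (∫ y, f y ∂μ + 1 / ((k : ℝ) + 1)) := by
    simp [birkhoffSum, Finset.sum_sub_distrib, mul_add]
  rw [h2] at h1
  rw [birkhoffAverage, smul_eq_mul, inv_mul_lt_iff₀ hnpos]
  have h3 : (M : ℝ) < n * (ε / 2) := by
    rw [div_lt_iff₀ (half_pos hε)] at hn₀
    have : (n₀ : ℝ) ≤ n := by exact_mod_cast (by omega : n₀ ≤ n)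
    nlinarith
  have h4 : (n : ℝ) * (1 / ((k : ℝ) + 1)) ≤ n * (ε / 2) := by gcongr
  linarith

/-- **Birkhoff's pointwise ergodic theorem** for an ergodic map of a probability space. -/
theorem Ergodic.ae_tendsto_birkhoffAverage (hτ : Ergodic τ μ) (hfm : Measurable f)
    (hf : Integrable f μ) :
    ∀ᵐ x ∂μ, Tendsto (fun n => birkhoffAverage ℝ τ f n x) atTop (𝓝 (∫ y, f y ∂μ)) := by
  filter_upwards [ae_eventually_birkhoffAverage_lt hτ hfm hf,
    ae_eventually_birkhoffAverage_lt hτ hfm.neg hf.neg] with x h1 h2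
  refine tendsto_order.2 ⟨fun b hb => ?_, fun b hb => ?_⟩
  · filter_upwards [h2 (∫ y, f y ∂μ - b) (by linarith)] with n hn
    simp only [Pi.neg_apply, integral_neg] at hn
    have : birkhoffAverage ℝ τ (-f) n x = - birkhoffAverage ℝ τ f n x := by
      simp [birkhoffAverage, birkhoffSum]
    linarith
  · filter_upwards [h1 (b - ∫ y, f y ∂μ) (by linarith)] with n hn
    linarith

end PointwiseErgodic

namespace AltNCF

/-! ### Branches of the map on irrational points -/

variable {a₁ a₂ N a b : ℕ} {x y t c : ℝ} {z : ℝ × ℝ}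

/-- The irrational points of `[a, a+1)`. Restricting to them discards a null set, and removes
both the end points and the point `0`. -/
def E (a : ℕ) : Set ℝ := {x | Irrational x ∧ x ∈ Set.Ioo (a : ℝ) (a + 1)}

/-- The irrational points of `Ω`. -/
def OmegaIrr (a₁ a₂ : ℕ) : Set ℝ := E a₁ ∪ E a₂

/-- The part of the natural extension domain `X` with irrational coordinates. -/
def G (a₁ a₂ : ℕ) : Set (ℝ × ℝ) := E a₁ ×ˢ E a₂ ∪ E a₂ ×ˢ E a₁

lemma E_subset_I : E a ⊆ I a := fun _ hx => ⟨hx.2.1.le, hx.2.2⟩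

lemma E.pos (hx : x ∈ E a) : 0 < x := a.cast_nonneg.trans_lt hx.2.1

lemma E.ne_zero (hx : x ∈ E a) : x ≠ 0 := (E.pos hx).ne'

/-- What the dynamics uses about the ordered pair `(a, b)`, which is `(a₁, a₂)` or `(a₂, a₁)`:
`T` sends `[a, a+1)` to `[b, b+1)`, with positive digits and full branches. -/
structure IsBranch (a₁ a₂ N a b : ℕ) : Prop where
  pos : 0 < N
  nextEnd_eq : ∀ x ∈ I a, nextEnd a₁ a₂ x = b
  digit_pos : ∀ x ∈ E a, 0 < digit a₁ a₂ N x
  dvd : a ≠ 0 → a ∣ N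
  dvd_succ : a + 1 ∣ N
  mul_le : (a + 1) * (b + 1) ≤ N
  mem_G : ∀ x ∈ E a, ∀ y ∈ E b, (x, y) ∈ G a₁ a₂
  mem_OmegaIrr : ∀ x ∈ E b, x ∈ OmegaIrr a₁ a₂

/-- Some point of `[a₁, a₁ + 1)` has the least possible quotient `⌊N / x⌋ = N / (a₁ + 1)`, and
its digit is positive. -/
lemma IsSimple.mul_le (hN : IsSimple a₁ a₂ N) : (a₁ + 1) * (a₂ + 1) ≤ N := by
  obtain ⟨hpos, hall, h1, ⟨k, hk⟩, -, -⟩ := hN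
  have hkpos : 0 < k := by
    rcases Nat.eq_zero_or_pos k with h | h
    · simp [h] at hk; omega
    · exact h
  have hkR : (N : ℝ) = (a₁ + 1) * k := by exact_mod_cast hk
  have hkR0 : (0 : ℝ) < k := by exact_mod_cast hkpos
  have hNR : (0 : ℝ) < N := by exact_mod_cast hpos
  -- `N / x` lies just above `k`; as `a₁` divides `N`, this `x` is not below `a₁`.
  set x : ℝ := N / (k + 1 / 2) with hx
  have hx0 : 0 < x := by positivity
  have hNx : (N : ℝ) / x = k + 1 / 2 := by rw [hx]; field_simp
  have hfl : ⌊(N : ℝ) / x⌋ = k := by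
    rw [hNx, Int.floor_eq_iff]; push_cast; constructor <;> linarith
  have hxI : x ∈ I a₁ := by
    constructor
    · rcases Nat.eq_zero_or_pos a₁ with h | h
      · simp [h, hx0.le]
      · obtain ⟨l, hl⟩ := h1 h.ne'
        have hkl : k < l := by
          by_contra hcon
          push Not at hcon
          have : a₁ * l ≤ a₁ * k := Nat.mul_le_mul_left _ hcon
          have : (a₁ + 1) * k = a₁ * k + k := by ring
          omega
        rw [hx, le_div_iff₀ (by positivity)]
        have hlR : (N : ℝ) = a₁ * l := by exact_mod_cast hl
        rw [hlR]
        gcongr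
        have : (k : ℝ) + 1 ≤ l := by exact_mod_cast hkl
        linarith
    · rw [hx, div_lt_iff₀ (by positivity), hkR]
      have : (0 : ℝ) ≤ a₁ := a₁.cast_nonneg
      nlinarith
  have hd := hall x (Or.inl hxI) hx0.ne'
  rw [digit, hfl, nextEnd, if_pos hxI] at hd
  have : a₂ + 1 ≤ k := by omega
  rw [hk]
  exact Nat.mul_le_mul_left _ this

lemma I_disjoint (h : a < b) (hx : x ∈ I b) : x ∉ I a := by
  intro hx'
  have : (a : ℝ) + 1 ≤ b := by exact_mod_cast h
  have := hx.1
  have := hx'.2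
  linarith

lemma isBranch_left (hN : IsSimple a₁ a₂ N) : IsBranch a₁ a₂ N a₁ a₂ where
  pos := hN.1
  nextEnd_eq _ hx := if_pos hx
  digit_pos x hx := hN.2.1 x (Or.inl (E_subset_I hx)) (E.ne_zero hx)
  dvd := hN.2.2.1
  dvd_succ := hN.2.2.2.1
  mul_le := hN.mul_le
  mem_G _ hx _ hy := Or.inl ⟨hx, hy⟩
  mem_OmegaIrr _ hx := Or.inr hx

lemma isBranch_right (ha : a₁ < a₂) (hN : IsSimple a₁ a₂ N) : IsBranch a₁ a₂ N a₂ a₁ where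
  pos := hN.1
  nextEnd_eq _ hx := if_neg (I_disjoint ha hx)
  digit_pos x hx := hN.2.1 x (Or.inr (E_subset_I hx)) (E.ne_zero hx)
  dvd := hN.2.2.2.2.1
  dvd_succ := hN.2.2.2.2.2
  mul_le := by rw [mul_comm]; exact hN.mul_le
  mem_G _ hx _ hy := Or.inr ⟨hx, hy⟩
  mem_OmegaIrr _ hx := Or.inl hx

lemma exists_isBranch (ha : a₁ < a₂) (hN : IsSimple a₁ a₂ N) (hx : x ∈ OmegaIrr a₁ a₂) :
    ∃ a b, IsBranch a₁ a₂ N a b ∧ IsBranch a₁ a₂ N b a ∧ x ∈ E a := by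
  rcases hx with hx | hx
  · exact ⟨a₁, a₂, isBranch_left hN, isBranch_right ha hN, hx⟩
  · exact ⟨a₂, a₁, isBranch_right ha hN, isBranch_left hN, hx⟩

lemma exists_isBranch_of_mem_G (ha : a₁ < a₂) (hN : IsSimple a₁ a₂ N) (hz : z ∈ G a₁ a₂) :
    ∃ a b, IsBranch a₁ a₂ N a b ∧ IsBranch a₁ a₂ N b a ∧ z.1 ∈ E a ∧ z.2 ∈ E b := by
  rcases hz with hz | hz
  · exact ⟨a₁, a₂, isBranch_left hN, isBranch_right ha hN, hz.1, hz.2⟩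
  · exact ⟨a₂, a₁, isBranch_right ha hN, isBranch_left hN, hz.1, hz.2⟩

namespace IsBranch

lemma posR (h : IsBranch a₁ a₂ N a b) : (0 : ℝ) < N := by exact_mod_cast h.pos

lemma mul_leR (h : IsBranch a₁ a₂ N a b) : ((a : ℝ) + 1) * (b + 1) ≤ N := by
  exact_mod_cast h.mul_le

lemma lt_N (h : IsBranch a₁ a₂ N a b) (hx : x ∈ E a) : x < N := by
  have := h.mul_leR
  have := hx.2.2
  have : (0 : ℝ) ≤ a := a.cast_nonneg
  have : (0 : ℝ) ≤ b := b.cast_nonneg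
  nlinarith

/-- The end points of `[a, a+1)` divide `N`, so the quotients `⌊N / x⌋` of its points range over
an interval of integers, and each of them is attained on a full branch. -/
lemma floor_bounds (h : IsBranch a₁ a₂ N a b) (hx : x ∈ E a) :
    (N : ℤ) ≤ ⌊(N : ℝ) / x⌋ * (a + 1) ∧ (⌊(N : ℝ) / x⌋ + 1) * a ≤ N := by
  have hx0 := E.pos hx
  have hN := h.posR
  constructor
  · obtain ⟨k, hk⟩ := h.dvd_succ
    have hkR : (N : ℝ) = (a + 1) * k := by exact_mod_cast hk
    have hk0 : (0 : ℝ) < k := by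
      by_contra hcon
      have : (k : ℝ) = 0 := le_antisymm (not_lt.1 hcon) k.cast_nonneg
      rw [this] at hkR
      linarith
    have : (k : ℤ) ≤ ⌊(N : ℝ) / x⌋ := by
      rw [Int.le_floor, le_div_iff₀ hx0, hkR, mul_comm]
      push_cast
      exact mul_le_mul_of_nonneg_right hx.2.2.le hk0.le
    have hkZ : (N : ℤ) = k * (a + 1) := by exact_mod_cast hk.trans (mul_comm _ _)
    calc (N : ℤ) = k * (a + 1) := hkZ
      _ ≤ _ := by gcongr
  · rcases Nat.eq_zero_or_pos a with ha | ha
    · simp [ha]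
    · obtain ⟨l, hl⟩ := h.dvd ha.ne'
      have hlR : (N : ℝ) = a * l := by exact_mod_cast hl
      have haR : (0 : ℝ) < a := by exact_mod_cast ha
      have hl0 : (0 : ℝ) < l := pos_of_mul_pos_right (hlR ▸ hN) haR.le
      have : ⌊(N : ℝ) / x⌋ < (l : ℤ) := by
        rw [Int.floor_lt, div_lt_iff₀ hx0, hlR, mul_comm]
        push_cast
        exact mul_lt_mul_of_pos_left hx.2.1 hl0
      have hlZ : (N : ℤ) = l * a := by exact_mod_cast hl.trans (mul_comm _ _)
      calc (⌊(N : ℝ) / x⌋ + 1) * (a : ℤ) ≤ l * a := by gcongr; omega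
        _ = N := hlZ.symm

lemma irrational_div (h : IsBranch a₁ a₂ N a b) (hx : x ∈ E a) : Irrational ((N : ℝ) / x) := by
  rw [irrational_natCast_div_iff]
  exact ⟨h.pos.ne', hx.1⟩

lemma digit_eq (h : IsBranch a₁ a₂ N a b) (hx : x ∈ E a) :
    digit a₁ a₂ N x = ⌊(N : ℝ) / x⌋ - b := by
  rw [digit, h.nextEnd_eq x (E_subset_I hx)]

lemma T_eq (h : IsBranch a₁ a₂ N a b) (hx : x ∈ E a) :
    T a₁ a₂ N x = N / x - digit a₁ a₂ N x := by
  rw [h.digit_eq hx, T, if_neg (E.ne_zero hx), h.nextEnd_eq x (E_subset_I hx)]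
  push_cast; ring

lemma one_le_digit (h : IsBranch a₁ a₂ N a b) (hx : x ∈ E a) :
    (1 : ℝ) ≤ digit a₁ a₂ N x := by
  exact_mod_cast h.digit_pos x hx

lemma T_mem (h : IsBranch a₁ a₂ N a b) (hx : x ∈ E a) : T a₁ a₂ N x ∈ E b := by
  have hirr : Irrational (T a₁ a₂ N x) := by
    rw [h.T_eq hx]
    exact (h.irrational_div hx).sub_intCast _
  refine ⟨hirr, ?_, ?_⟩
  · refine lt_of_le_of_ne ?_ (hirr.ne_nat b).symm
    rw [h.T_eq hx, h.digit_eq hx]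
    push_cast
    linarith [Int.floor_le ((N : ℝ) / x)]
  · rw [h.T_eq hx, h.digit_eq hx]
    push_cast
    linarith [Int.lt_floor_add_one ((N : ℝ) / x)]

lemma div_digit_add_T (h : IsBranch a₁ a₂ N a b) (hx : x ∈ E a) :
    (N : ℝ) / (digit a₁ a₂ N x + T a₁ a₂ N x) = x := by
  have := E.ne_zero hx
  have := h.posR
  rw [h.T_eq hx, add_sub_cancel]
  field_simp

/-- The inverse branch through `x`, applied to a point of the target interval. -/
lemma inverse_branch (h : IsBranch a₁ a₂ N a b) (hx : x ∈ E a) (ht : t ∈ E b) :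
    (N : ℝ) / (digit a₁ a₂ N x + t) ∈ E a ∧
      digit a₁ a₂ N (N / (digit a₁ a₂ N x + t)) = digit a₁ a₂ N x ∧
      T a₁ a₂ N (N / (digit a₁ a₂ N x + t)) = t := by
  have hN := h.posR
  obtain ⟨hf1, hf2⟩ := h.floor_bounds hx
  set m := ⌊(N : ℝ) / x⌋ with hm
  set s : ℝ := digit a₁ a₂ N x + t with hs
  have hdm : (digit a₁ a₂ N x : ℝ) = m - b := by rw [h.digit_eq hx]; push_cast; rfl
  have hs1 : (m : ℝ) < s := by rw [hs, hdm]; linarith [ht.2.1]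
  have hs2 : s < m + 1 := by rw [hs, hdm]; linarith [ht.2.2]
  have hs0 : 0 < s := by
    have := h.one_le_digit hx
    have := E.pos ht
    linarith
  have hf1R : (N : ℝ) ≤ m * (a + 1) := by exact_mod_cast hf1
  have hf2R : ((m : ℝ) + 1) * a ≤ N := by exact_mod_cast hf2
  have ha0 : (0 : ℝ) ≤ a := a.cast_nonneg
  have hirr : Irrational ((N : ℝ) / s) := by
    rw [irrational_natCast_div_iff]
    exact ⟨h.pos.ne', ht.1.intCast_add _⟩
  have hwE : (N : ℝ) / s ∈ E a := by
    refine ⟨hirr, ?_, ?_⟩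
    · rw [lt_div_iff₀ hs0]
      rcases eq_or_lt_of_le ha0 with h0 | h0
      · rw [← h0]; simpa using hN
      · nlinarith
    · rw [div_lt_iff₀ hs0]
      nlinarith
  have hNw : (N : ℝ) / (N / s) = s := by field_simp
  have hfl : ⌊(N : ℝ) / (N / s)⌋ = m := by
    rw [hNw, Int.floor_eq_iff]; exact ⟨hs1.le, hs2⟩
  have hd : digit a₁ a₂ N (N / s) = digit a₁ a₂ N x := by
    rw [h.digit_eq hwE, h.digit_eq hx, hfl]
  refine ⟨hwE, hd, ?_⟩
  rw [h.T_eq hwE, hNw, hd, hs]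
  ring

end IsBranch

lemma T_mem_OmegaIrr (ha : a₁ < a₂) (hN : IsSimple a₁ a₂ N) (hx : x ∈ OmegaIrr a₁ a₂) :
    T a₁ a₂ N x ∈ OmegaIrr a₁ a₂ := by
  obtain ⟨a, b, h, -, hxa⟩ := exists_isBranch ha hN hx
  exact h.mem_OmegaIrr _ (h.T_mem hxa)

lemma iterate_T_mem_OmegaIrr (ha : a₁ < a₂) (hN : IsSimple a₁ a₂ N) (hx : x ∈ OmegaIrr a₁ a₂)
    (n : ℕ) : (T a₁ a₂ N)^[n] x ∈ OmegaIrr a₁ a₂ := by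
  induction n with
  | zero => exact hx
  | succ n ih => rw [Function.iterate_succ_apply']; exact T_mem_OmegaIrr ha hN ih

/-! ### The natural extension -/

/-- The natural extension map `(x, y) ↦ (T x, N / (d₁(x) + y))`. -/
def natExt (a₁ a₂ N : ℕ) (z : ℝ × ℝ) : ℝ × ℝ :=
  (T a₁ a₂ N z.1, N / (digit a₁ a₂ N z.1 + z.2))

lemma natExt_mem_G (ha : a₁ < a₂) (hN : IsSimple a₁ a₂ N) (hz : z ∈ G a₁ a₂) :
    natExt a₁ a₂ N z ∈ G a₁ a₂ := by
  obtain ⟨a, b, h, h', h1, h2⟩ := exists_isBranch_of_mem_G ha hN hz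
  exact h'.mem_G _ (h.T_mem h1) _ (h.inverse_branch h1 h2).1

lemma swap_mem_G : z.swap ∈ G a₁ a₂ ↔ z ∈ G a₁ a₂ := by
  simp only [G, Set.mem_union, Set.mem_prod, Prod.fst_swap, Prod.snd_swap]
  tauto

/-- Exchanging the coordinates conjugates the natural extension to its inverse. -/
lemma natExt_swap_natExt (ha : a₁ < a₂) (hN : IsSimple a₁ a₂ N) (hz : z ∈ G a₁ a₂) :
    natExt a₁ a₂ N (natExt a₁ a₂ N z).swap = z.swap := by
  obtain ⟨a, b, h, h', h1, h2⟩ := exists_isBranch_of_mem_G ha hN hz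
  obtain ⟨-, hd, hT⟩ := h.inverse_branch h1 h2
  simp only [natExt, Prod.swap_prod_mk, hT, hd, h.div_digit_add_T h1]
  rfl

lemma injOn_natExt (ha : a₁ < a₂) (hN : IsSimple a₁ a₂ N) :
    Set.InjOn (natExt a₁ a₂ N) (G a₁ a₂) := by
  intro z hz w hw hzw
  have := natExt_swap_natExt ha hN hz
  rw [hzw, natExt_swap_natExt ha hN hw] at this
  exact (Prod.swap_injective this).symm

lemma image_natExt (ha : a₁ < a₂) (hN : IsSimple a₁ a₂ N) :
    natExt a₁ a₂ N '' G a₁ a₂ = G a₁ a₂ := by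
  refine Set.Subset.antisymm ?_ fun z hz => ?_
  · rintro _ ⟨z, hz, rfl⟩
    exact natExt_mem_G ha hN hz
  · refine ⟨(natExt a₁ a₂ N z.swap).swap,
      swap_mem_G.2 (natExt_mem_G ha hN (swap_mem_G.2 hz)), ?_⟩
    rw [natExt_swap_natExt ha hN (swap_mem_G.2 hz), Prod.swap_swap]

/-- The derivative of the natural extension, a diagonal matrix. -/
def natExtDeriv (a₁ a₂ N : ℕ) (z : ℝ × ℝ) : ℝ × ℝ →L[ℝ] ℝ × ℝ :=
  (ContinuousLinearMap.toSpanSingleton ℝ (-(N : ℝ) / z.1 ^ 2)).prodMap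
    (ContinuousLinearMap.toSpanSingleton ℝ (-(N : ℝ) / (digit a₁ a₂ N z.1 + z.2) ^ 2))

/-- At an irrational point the digit is locally constant, so the natural extension is
differentiable there. -/
lemma hasFDerivAt_natExt (ha : a₁ < a₂) (hN : IsSimple a₁ a₂ N) (hz : z ∈ G a₁ a₂) :
    HasFDerivAt (natExt a₁ a₂ N) (natExtDeriv a₁ a₂ N z) z := by
  obtain ⟨a, b, h, h', h1, h2⟩ := exists_isBranch_of_mem_G ha hN hz
  have hx0 := E.pos h1
  have hd := h.one_le_digit h1
  have hy0 := E.pos h2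
  set m : ℤ := digit a₁ a₂ N z.1 with hm
  have hf : HasDerivAt (fun x : ℝ => (N : ℝ) / x - m) (-(N : ℝ) / z.1 ^ 2) z.1 := by
    have := ((hasDerivAt_const z.1 (N : ℝ)).div (hasDerivAt_id z.1) hx0.ne').sub_const (m : ℝ)
    exact this.congr_deriv (by simp)
  have hg : HasDerivAt (fun y : ℝ => (N : ℝ) / (m + y)) (-(N : ℝ) / (m + z.2) ^ 2) z.2 := by
    have := (hasDerivAt_const z.2 (N : ℝ)).div ((hasDerivAt_id z.2).const_add (m : ℝ))
      (by simp only [id]; linarith)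
    exact this.congr_deriv (by simp)
  have hprod := hf.hasFDerivAt.prodMap z hg.hasFDerivAt
  refine hprod.congr_of_eventuallyEq ?_
  have hloc : ∀ᶠ x in 𝓝 z.1, T a₁ a₂ N x = N / x - m ∧ digit a₁ a₂ N x = m := by
    have hc : ContinuousAt (fun x : ℝ => (N : ℝ) / x) z.1 :=
      continuousAt_const.div continuousAt_id hx0.ne'
    have hfl : ∀ᶠ x in 𝓝 z.1, (N : ℝ) / x ∈
        Set.Ioo (⌊(N : ℝ) / z.1⌋ : ℝ) (⌊(N : ℝ) / z.1⌋ + 1) := by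
      refine hc.eventually (Ioo_mem_nhds ?_ (Int.lt_floor_add_one _))
      exact lt_of_le_of_ne (Int.floor_le _) ((h.irrational_div h1).ne_int _).symm
    filter_upwards [Ioo_mem_nhds h1.2.1 h1.2.2, hfl, lt_mem_nhds hx0] with x hxI hxf hx
    have hfx : ⌊(N : ℝ) / x⌋ = ⌊(N : ℝ) / z.1⌋ := Int.floor_eq_iff.2 ⟨hxf.1.le, hxf.2⟩
    have hne : nextEnd a₁ a₂ x = b := h.nextEnd_eq x ⟨hxI.1.le, hxI.2⟩
    have hdx : digit a₁ a₂ N x = m := by rw [digit, hne, hfx, hm, h.digit_eq h1]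
    refine ⟨?_, hdx⟩
    rw [← hdx, T, if_neg hx.ne', digit]
    push_cast; ring
  have hloc' : ∀ᶠ w : ℝ × ℝ in 𝓝 z, T a₁ a₂ N w.1 = N / w.1 - m ∧ digit a₁ a₂ N w.1 = m :=
    continuous_fst.continuousAt.eventually hloc
  filter_upwards [hloc'] with w hw
  simp only [natExt, hw.1, hw.2, Prod.map]

lemma det_natExtDeriv : (natExtDeriv a₁ a₂ N z).det =
    (-(N : ℝ) / z.1 ^ 2) * (-(N : ℝ) / (digit a₁ a₂ N z.1 + z.2) ^ 2) := by
  rw [← ContinuousLinearMap.det_toSpanSingleton (-(N : ℝ) / z.1 ^ 2),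
    ← ContinuousLinearMap.det_toSpanSingleton (-(N : ℝ) / (digit a₁ a₂ N z.1 + z.2) ^ 2)]
  exact LinearMap.det_prodMap _ _

/-- The density `N / (N + x y)²` is invariant under the natural extension. -/
lemma abs_det_mul_density (ha : a₁ < a₂) (hN : IsSimple a₁ a₂ N) (hz : z ∈ G a₁ a₂) :
    |(natExtDeriv a₁ a₂ N z).det| * density N (natExt a₁ a₂ N z) = density N z := by
  obtain ⟨a, b, h, h', h1, h2⟩ := exists_isBranch_of_mem_G ha hN hz
  have hx0 := E.pos h1
  have hd := h.one_le_digit h1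
  have hy0 := E.pos h2
  have hN0 := h.posR
  set m : ℝ := (digit a₁ a₂ N z.1 : ℝ) with hm
  have hmy : 0 < m + z.2 := by linarith
  have hxy : 0 < N + z.1 * z.2 := by positivity
  have key : (N : ℝ) + (N / z.1 - m) * (N / (m + z.2))
      = N * (N + z.1 * z.2) / (z.1 * (m + z.2)) := by
    field_simp
    ring
  rw [det_natExtDeriv, ← hm, neg_div, neg_div, neg_mul_neg, abs_of_pos (by positivity)]
  simp only [density, natExt]
  rw [h.T_eq h1, ← hm, key]
  field_simp

lemma measurable_nextEnd : Measurable (nextEnd a₁ a₂) := by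
  unfold nextEnd
  exact Measurable.ite measurableSet_Ico measurable_const measurable_const

lemma measurable_digit : Measurable (digit a₁ a₂ N) := by
  unfold digit
  exact (Int.measurable_floor.comp (measurable_const.div measurable_id)).sub
    ((measurable_from_top (f := fun n : ℕ => (n : ℤ))).comp measurable_nextEnd)

lemma measurable_T : Measurable (T a₁ a₂ N) := by
  unfold T
  refine Measurable.ite (measurableSet_singleton 0) measurable_const ?_
  exact ((measurable_const.div measurable_id).sub
    ((measurable_from_top (f := fun n : ℤ => (n : ℝ))).comp
      (Int.measurable_floor.comp (measurable_const.div measurable_id)))).add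
    ((measurable_from_top (f := fun n : ℕ => (n : ℝ))).comp measurable_nextEnd)

lemma measurable_natExt : Measurable (natExt a₁ a₂ N) := by
  unfold natExt
  refine (measurable_T.comp measurable_fst).prodMk (measurable_const.div ?_)
  exact ((measurable_from_top (f := fun n : ℤ => (n : ℝ))).comp
    (measurable_digit.comp measurable_fst)).add measurable_snd

/-! ### Convergents -/

lemma IsBranch.unique {a' b' : ℕ} (h : IsBranch a₁ a₂ N a b) (h' : IsBranch a₁ a₂ N a' b')
    (hx : x ∈ E a) (hx' : x ∈ E a') : a = a' ∧ b = b' := by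
  have h1 : a < a' + 1 := by exact_mod_cast hx.2.1.trans hx'.2.2
  have h2 : a' < a + 1 := by exact_mod_cast hx'.2.1.trans hx.2.2
  refine ⟨by omega, ?_⟩
  rw [← h.nextEnd_eq x (E_subset_I hx), h'.nextEnd_eq x (E_subset_I hx')]

lemma one_le_d (ha : a₁ < a₂) (hN : IsSimple a₁ a₂ N) (hx : x ∈ OmegaIrr a₁ a₂) (n : ℕ) :
    (1 : ℝ) ≤ d a₁ a₂ N x n := by
  obtain ⟨a, b, h, -, hxa⟩ := exists_isBranch ha hN (iterate_T_mem_OmegaIrr ha hN hx (n - 1))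
  exact h.one_le_digit hxa

lemma p_succ_succ (n : ℕ) : (p a₁ a₂ N x (n + 2) : ℝ) =
    d a₁ a₂ N x (n + 2) * p a₁ a₂ N x (n + 1) + N * p a₁ a₂ N x n := by
  rw [p]; push_cast; rfl

lemma q_succ_succ (n : ℕ) : (q a₁ a₂ N x (n + 2) : ℝ) =
    d a₁ a₂ N x (n + 2) * q a₁ a₂ N x (n + 1) + N * q a₁ a₂ N x n := by
  rw [q]; push_cast; rfl

lemma q_pos (ha : a₁ < a₂) (hN : IsSimple a₁ a₂ N) (hx : x ∈ OmegaIrr a₁ a₂) (n : ℕ) :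
    (0 : ℝ) < q a₁ a₂ N x n := by
  have hd := one_le_d ha hN hx
  induction n using Nat.twoStepInduction with
  | zero => simp [q]
  | one => rw [q]; linarith [hd 1]
  | more n h0 h1 =>
    rw [q_succ_succ]
    have : (0 : ℝ) < N := by exact_mod_cast hN.1
    have := hd (n + 2)
    positivity

lemma q_le_succ (ha : a₁ < a₂) (hN : IsSimple a₁ a₂ N) (hx : x ∈ OmegaIrr a₁ a₂) (n : ℕ) :
    (q a₁ a₂ N x n : ℝ) ≤ q a₁ a₂ N x (n + 1) := by
  have hd := one_le_d ha hN hx (n + 1)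
  rcases n with _ | n
  · simpa [q] using hd
  · rw [q_succ_succ]
    have := q_pos ha hN hx n
    have := q_pos ha hN hx (n + 1)
    have : (0 : ℝ) ≤ N * q a₁ a₂ N x n := by positivity
    nlinarith

/-- Digits are at least `1`, so `qₙ² / Nⁿ` grows exponentially. -/
lemma pow_le_q_sq (ha : a₁ < a₂) (hN : IsSimple a₁ a₂ N) (hx : x ∈ OmegaIrr a₁ a₂) (n : ℕ) :
    ((N : ℝ) + 1) ^ n ≤ (N + 1) * (q a₁ a₂ N x n : ℝ) ^ 2 := by
  have hN0 : (0 : ℝ) < N := by exact_mod_cast hN.1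
  induction n using Nat.twoStepInduction with
  | zero => simp [q]
  | one =>
    have := q_le_succ ha hN hx 0
    rw [zero_add, show (q a₁ a₂ N x 0 : ℝ) = 1 by simp [q]] at this
    rw [pow_one]
    exact le_mul_of_one_le_right (by positivity) (one_le_pow₀ this)
  | more n h0 _ =>
    have h1 : ((N : ℝ) + 1) * q a₁ a₂ N x n ≤ q a₁ a₂ N x (n + 2) := by
      rw [q_succ_succ]
      have := q_le_succ ha hN hx n
      have := q_pos ha hN hx (n + 1)
      have := one_le_d ha hN hx (n + 2)
      nlinarith
    have hq := q_pos ha hN hx n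
    calc ((N : ℝ) + 1) ^ (n + 2) = (N + 1) ^ 2 * (N + 1) ^ n := by ring
      _ ≤ (N + 1) ^ 2 * ((N + 1) * (q a₁ a₂ N x n : ℝ) ^ 2) := by gcongr
      _ = (N + 1) * (((N : ℝ) + 1) * q a₁ a₂ N x n) ^ 2 := by ring
      _ ≤ _ := by gcongr

/-- The determinant of two consecutive convergents. -/
lemma det_convergents (n : ℕ) : (p a₁ a₂ N x n : ℝ) * q a₁ a₂ N x (n + 1)
    - p a₁ a₂ N x (n + 1) * q a₁ a₂ N x n = (-1) ^ (n + 1) * (N : ℝ) ^ (n + 1) := by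
  induction n with
  | zero => simp [p, q]
  | succ n ih =>
    rw [p_succ_succ, q_succ_succ, pow_succ, pow_succ (N : ℝ)]
    linear_combination (-(N : ℝ)) * ih

/-- The inverse branch of `T^(n+1)` through `x`, as a Möbius map. -/
def mobius (a₁ a₂ N : ℕ) (x : ℝ) (n : ℕ) (t : ℝ) : ℝ :=
  (p a₁ a₂ N x (n + 1) + p a₁ a₂ N x n * t) / (q a₁ a₂ N x (n + 1) + q a₁ a₂ N x n * t)

lemma mobius_zero : mobius a₁ a₂ N x 0 t = N / (digit a₁ a₂ N x + t) := by
  simp [mobius, p, q, d]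

lemma mobius_succ (ha : a₁ < a₂) (hN : IsSimple a₁ a₂ N) (hx : x ∈ OmegaIrr a₁ a₂) (n : ℕ)
    (ht : 0 ≤ t) :
    mobius a₁ a₂ N x (n + 1) t = mobius a₁ a₂ N x n (N / (d a₁ a₂ N x (n + 2) + t)) := by
  have hd : (0 : ℝ) < d a₁ a₂ N x (n + 2) + t := by linarith [one_le_d ha hN hx (n + 2)]
  have h0 := q_pos ha hN hx n
  have h1 := q_pos ha hN hx (n + 1)
  have h2 := q_pos ha hN hx (n + 2)
  have hN0 : (0 : ℝ) < N := by exact_mod_cast hN.1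
  have hA : 0 < (q a₁ a₂ N x (n + 2) : ℝ) + q a₁ a₂ N x (n + 1) * t := by positivity
  have hB : 0 < (q a₁ a₂ N x (n + 1) : ℝ)
    + q a₁ a₂ N x n * (N / (d a₁ a₂ N x (n + 2) + t)) := by positivity
  rw [mobius, mobius, div_eq_div_iff hA.ne' hB.ne', p_succ_succ, q_succ_succ]
  field_simp
  ring

lemma mobius_iterate_T (ha : a₁ < a₂) (hN : IsSimple a₁ a₂ N) (hx : x ∈ OmegaIrr a₁ a₂)
    (n : ℕ) : mobius a₁ a₂ N x n ((T a₁ a₂ N)^[n + 1] x) = x := by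
  induction n with
  | zero =>
    obtain ⟨a, b, h, -, hxa⟩ := exists_isBranch ha hN hx
    rw [mobius_zero]
    exact h.div_digit_add_T hxa
  | succ n ih =>
    obtain ⟨a, b, h, -, hxa⟩ :=
      exists_isBranch ha hN (iterate_T_mem_OmegaIrr ha hN hx (n + 1))
    have hT := h.T_mem hxa
    rw [← Function.iterate_succ_apply' (T a₁ a₂ N)] at hT
    rw [mobius_succ ha hN hx n (E.pos hT).le]
    convert ih using 2
    have := h.div_digit_add_T hxa
    rwa [← Function.iterate_succ_apply' (T a₁ a₂ N)] at this

/-- The Möbius map is a full branch: it is a section of `T^(n+1)` over the whole interval that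
contains `T^(n+1) x`. -/
lemma iterate_T_mobius (ha : a₁ < a₂) (hN : IsSimple a₁ a₂ N) (hx : x ∈ OmegaIrr a₁ a₂)
    (n : ℕ) (h : IsBranch a₁ a₂ N a b) (hab : (T a₁ a₂ N)^[n] x ∈ E a) (ht : t ∈ E b) :
    (T a₁ a₂ N)^[n + 1] (mobius a₁ a₂ N x n t) = t := by
  induction n generalizing a b t with
  | zero =>
    rw [mobius_zero]
    exact (h.inverse_branch hab ht).2.2
  | succ n ih =>
    obtain ⟨a', b', h1, h2, hxa⟩ := exists_isBranch ha hN (iterate_T_mem_OmegaIrr ha hN hx n)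
    have hT := h1.T_mem hxa
    rw [← Function.iterate_succ_apply' (T a₁ a₂ N)] at hT
    obtain ⟨rfl, rfl⟩ := h.unique h2 hab hT
    obtain ⟨hw, -, hTw⟩ := h.inverse_branch hab ht
    rw [mobius_succ ha hN hx n (E.pos ht).le, Function.iterate_succ_apply']
    have := ih h1 hxa hw
    simp only [d, show n + 2 - 1 = n + 1 from rfl]
    rw [this, hTw]

lemma mobius_sub_mobius {t' : ℝ} (ha : a₁ < a₂) (hN : IsSimple a₁ a₂ N)
    (hx : x ∈ OmegaIrr a₁ a₂) (n : ℕ) (ht : 0 ≤ t) (ht' : 0 ≤ t') :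
    |mobius a₁ a₂ N x n t - mobius a₁ a₂ N x n t'|
      ≤ (N : ℝ) ^ (n + 1) / (q a₁ a₂ N x (n + 1) : ℝ) ^ 2 * |t - t'| := by
  have h0 := q_pos ha hN hx n
  have h1 := q_pos ha hN hx (n + 1)
  set Q := (q a₁ a₂ N x (n + 1) : ℝ)
  set Q' := (q a₁ a₂ N x n : ℝ)
  have hA : 0 < Q + Q' * t := by positivity
  have hB : 0 < Q + Q' * t' := by positivity
  have key : mobius a₁ a₂ N x n t - mobius a₁ a₂ N x n t'
      = (-1) ^ (n + 1) * (N : ℝ) ^ (n + 1) * (t - t') / ((Q + Q' * t) * (Q + Q' * t')) := by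
    rw [mobius, mobius, div_sub_div _ _ hA.ne' hB.ne', ← det_convergents (a₁ := a₁) (a₂ := a₂)
      (x := x) n]
    congr 1
    ring
  rw [key, abs_div, abs_mul, abs_mul, abs_pow, abs_neg, abs_one, one_pow, one_mul,
    abs_of_nonneg (by positivity : (0 : ℝ) ≤ (N : ℝ) ^ (n + 1)),
    abs_of_pos (mul_pos hA hB), div_mul_eq_mul_div]
  refine div_le_div_of_nonneg_left (by positivity) (by positivity) ?_
  rw [sq]
  gcongr
  · exact le_add_of_nonneg_right (by positivity)
  · exact le_add_of_nonneg_right (by positivity)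

lemma hasDerivAt_mobius (ha : a₁ < a₂) (hN : IsSimple a₁ a₂ N) (hx : x ∈ OmegaIrr a₁ a₂)
    (n : ℕ) (ht : 0 ≤ t) :
    HasDerivAt (mobius a₁ a₂ N x n) ((-1) ^ (n + 1) * (N : ℝ) ^ (n + 1) /
      ((q a₁ a₂ N x (n + 1) : ℝ) + q a₁ a₂ N x n * t) ^ 2) t := by
  have h0 := q_pos ha hN hx n
  have h1 := q_pos ha hN hx (n + 1)
  have hA : 0 < (q a₁ a₂ N x (n + 1) : ℝ) + q a₁ a₂ N x n * t := by positivity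
  have := (((hasDerivAt_id t).const_mul (p a₁ a₂ N x n : ℝ)).const_add
    (p a₁ a₂ N x (n + 1) : ℝ)).div (((hasDerivAt_id t).const_mul (q a₁ a₂ N x n : ℝ)).const_add
    (q a₁ a₂ N x (n + 1) : ℝ)) hA.ne'
  refine this.congr_deriv ?_
  rw [← det_convergents (a₁ := a₁) (a₂ := a₂) (x := x) n]
  simp only [id]
  congr 1
  ring

/-! ### Approximation coefficients along the natural extension -/

/-- The function `N x / (N + x y)`, whose values along the natural extension are the
approximation coefficients. -/
def thetaFun (N : ℕ) (z : ℝ × ℝ) : ℝ := (N : ℝ) * z.1 / (N + z.1 * z.2)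

lemma fst_iterate_natExt (n : ℕ) (z : ℝ × ℝ) :
    ((natExt a₁ a₂ N)^[n] z).1 = (T a₁ a₂ N)^[n] z.1 := by
  induction n with
  | zero => rfl
  | succ n ih => rw [Function.iterate_succ_apply', Function.iterate_succ_apply', natExt, ih]

lemma iterate_natExt_zero (ha : a₁ < a₂) (hN : IsSimple a₁ a₂ N) (hx : x ∈ OmegaIrr a₁ a₂)
    (n : ℕ) : (natExt a₁ a₂ N)^[n + 1] (x, 0) =
      ((T a₁ a₂ N)^[n + 1] x, (N : ℝ) * q a₁ a₂ N x n / q a₁ a₂ N x (n + 1)) := by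
  refine Prod.ext (fst_iterate_natExt _ _) ?_
  induction n with
  | zero => simp [natExt, q, d]
  | succ n ih =>
    rw [Function.iterate_succ_apply', natExt, ih, fst_iterate_natExt, q_succ_succ]
    have h1 := q_pos ha hN hx (n + 1)
    have h0 := q_pos ha hN hx n
    have hd := one_le_d ha hN hx (n + 2)
    have hN0 : (0 : ℝ) < N := by exact_mod_cast hN.1
    have : digit a₁ a₂ N ((T a₁ a₂ N)^[n + 1] x) = d a₁ a₂ N x (n + 2) := rfl
    simp only [this]
    have e : (d a₁ a₂ N x (n + 2) : ℝ) + N * q a₁ a₂ N x n / q a₁ a₂ N x (n + 1)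
      = (d a₁ a₂ N x (n + 2) * q a₁ a₂ N x (n + 1) + N * q a₁ a₂ N x n)
        / q a₁ a₂ N x (n + 1) := by field_simp
    rw [e]
    field_simp

/-- The approximation coefficient `θₙ(x)` is read off the orbit of `(x, 0)`, because its second
coordinate is `N qₙ₋₁ / qₙ`. -/
lemma theta_eq (ha : a₁ < a₂) (hN : IsSimple a₁ a₂ N) (hx : x ∈ OmegaIrr a₁ a₂) (n : ℕ) :
    theta a₁ a₂ N (n + 1) x = thetaFun N ((natExt a₁ a₂ N)^[n + 1] (x, 0)) := by
  rw [iterate_natExt_zero ha hN hx, theta, thetaFun]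
  have hT : 0 < (T a₁ a₂ N)^[n + 1] x := by
    rcases iterate_T_mem_OmegaIrr ha hN hx (n + 1) with h | h <;> exact E.pos h
  have hx' := mobius_iterate_T ha hN hx n
  set t := (T a₁ a₂ N)^[n + 1] x
  have h1 := q_pos ha hN hx (n + 1)
  have h0 := q_pos ha hN hx n
  have hN0 : (0 : ℝ) < N := by exact_mod_cast hN.1
  set Q := (q a₁ a₂ N x (n + 1) : ℝ)
  set Q' := (q a₁ a₂ N x n : ℝ)
  have hA : 0 < Q + Q' * t := by positivity
  have key : x - p a₁ a₂ N x (n + 1) / Q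
      = (-1) ^ (n + 1) * (N : ℝ) ^ (n + 1) * t / ((Q + Q' * t) * Q) := by
    have hsub : x - p a₁ a₂ N x (n + 1) / Q
        = mobius a₁ a₂ N x n t - p a₁ a₂ N x (n + 1) / Q := by rw [hx']
    rw [hsub, ← det_convergents (a₁ := a₁) (a₂ := a₂) (x := x) n, mobius,
      div_sub_div _ _ hA.ne' h1.ne']
    congr 1
    ring
  rw [key, abs_div, abs_mul, abs_mul, abs_pow, abs_neg, abs_one, one_pow, one_mul,
    abs_of_nonneg (by positivity : (0 : ℝ) ≤ (N : ℝ) ^ (n + 1)), abs_of_pos hT,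
    abs_of_pos (by positivity : 0 < (Q + Q' * t) * Q), Finset.prod_const, Nat.card_Icc,
    Nat.add_sub_cancel]
  have e : (N : ℝ) + t * (N * Q' / Q) = N * (Q + Q' * t) / Q := by field_simp
  simp only [e]
  field_simp

/-- Two steps of the second coordinate of the natural extension are a contraction. -/
lemma abs_div_sub_div_le {M d d' y y' : ℝ} (hM : 0 < M) (hd : 1 ≤ d) (hd' : 1 ≤ d')
    (hy : 0 ≤ y) (hy' : 0 ≤ y') :
    |M / (d' + M / (d + y)) - M / (d' + M / (d + y'))| ≤ (M / (M + 1)) ^ 2 * |y - y'| := by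
  have h1 : 0 < d + y := by linarith
  have h2 : 0 < d + y' := by linarith
  have hA : M + 1 ≤ d' * (d + y) + M := by nlinarith
  have hB : M + 1 ≤ d' * (d + y') + M := by nlinarith
  have hA0 : 0 < d' * (d + y) + M := by linarith
  have hB0 : 0 < d' * (d + y') + M := by linarith
  have e1 : M / (d' + M / (d + y)) = M * (d + y) / (d' * (d + y) + M) := by
    field_simp
  have e2 : M / (d' + M / (d + y')) = M * (d + y') / (d' * (d + y') + M) := by
    field_simp
  have key : M / (d' + M / (d + y)) - M / (d' + M / (d + y'))
      = M ^ 2 * (y - y') / ((d' * (d + y) + M) * (d' * (d + y') + M)) := by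
    rw [e1, e2, div_sub_div _ _ hA0.ne' hB0.ne']
    congr 1
    ring
  rw [key, abs_div, abs_mul, abs_of_nonneg (sq_nonneg M), abs_of_pos (mul_pos hA0 hB0),
    div_pow, div_mul_eq_mul_div]
  refine div_le_div_of_nonneg_left (by positivity) (by positivity) ?_
  rw [sq]
  gcongr

lemma snd_natExt_mem (ha : a₁ < a₂) (hN : IsSimple a₁ a₂ N) (hx : z.1 ∈ OmegaIrr a₁ a₂)
    (hy : z.2 ∈ Set.Icc (0 : ℝ) N) : (natExt a₁ a₂ N z).2 ∈ Set.Icc (0 : ℝ) N := by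
  obtain ⟨a, b, h, -, hxa⟩ := exists_isBranch ha hN hx
  have hd := h.one_le_digit hxa
  have := hy.1
  constructor
  · simp only [natExt]
    positivity
  · simp only [natExt]
    exact div_le_self h.posR.le (by linarith)

lemma snd_iterate_natExt_mem (ha : a₁ < a₂) (hN : IsSimple a₁ a₂ N) (hx : z.1 ∈ OmegaIrr a₁ a₂)
    (hy : z.2 ∈ Set.Icc (0 : ℝ) N) (n : ℕ) :
    ((natExt a₁ a₂ N)^[n] z).2 ∈ Set.Icc (0 : ℝ) N := by
  induction n with
  | zero => exact hy
  | succ n ih =>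
    rw [Function.iterate_succ_apply']
    refine snd_natExt_mem ha hN ?_ ih
    rw [fst_iterate_natExt]
    exact iterate_T_mem_OmegaIrr ha hN hx n

/-- The second coordinate forgets its initial value at an exponential rate. -/
lemma abs_snd_iterate_natExt_sub_le {y' : ℝ} (ha : a₁ < a₂) (hN : IsSimple a₁ a₂ N)
    (hx : x ∈ OmegaIrr a₁ a₂) (hy : y ∈ Set.Icc (0 : ℝ) N) (hy' : y' ∈ Set.Icc (0 : ℝ) N)
    (m : ℕ) :
    |((natExt a₁ a₂ N)^[2 * m] (x, y)).2 - ((natExt a₁ a₂ N)^[2 * m] (x, y')).2|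
      ≤ ((N : ℝ) / (N + 1)) ^ (2 * m) * N := by
  have hN0 : (0 : ℝ) < N := by exact_mod_cast hN.1
  induction m with
  | zero =>
    simp only [mul_zero, Function.iterate_zero, id, pow_zero, one_mul]
    rw [abs_le]
    constructor <;> linarith [hy.1, hy.2, hy'.1, hy'.2]
  | succ m ih =>
    have e : 2 * (m + 1) = 2 * m + 1 + 1 := by ring
    rw [e]
    simp only [Function.iterate_succ_apply' (natExt a₁ a₂ N)]
    have h1 := one_le_d ha hN hx (2 * m + 1)
    have h2 := one_le_d ha hN hx (2 * m + 2)
    have hA := snd_iterate_natExt_mem ha hN (z := (x, y)) hx hy (2 * m)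
    have hB := snd_iterate_natExt_mem ha hN (z := (x, y')) hx hy' (2 * m)
    have hfA := fst_iterate_natExt (a₁ := a₁) (a₂ := a₂) (N := N) (2 * m) (x, y)
    have hfB := fst_iterate_natExt (a₁ := a₁) (a₂ := a₂) (N := N) (2 * m) (x, y')
    simp only [natExt, hfA, hfB] at *
    rw [d, Nat.add_sub_cancel] at h1
    rw [d, show 2 * m + 2 - 1 = 2 * m + 1 from rfl, Function.iterate_succ_apply'] at h2
    refine (abs_div_sub_div_le hN0 h1 h2 hA.1 hB.1).trans ?_
    calc _ ≤ ((N : ℝ) / (N + 1)) ^ 2 * (((N : ℝ) / (N + 1)) ^ (2 * m) * N) := by gcongr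
      _ = _ := by ring

lemma abs_thetaFun_sub_le {y' : ℝ} (ha : a₁ < a₂) (hN : IsSimple a₁ a₂ N)
    (hx : x ∈ OmegaIrr a₁ a₂) (hy : 0 ≤ y) (hy' : 0 ≤ y') :
    |thetaFun N (x, y) - thetaFun N (x, y')| ≤ N * |y - y'| := by
  have hN0 : (0 : ℝ) < N := by exact_mod_cast hN.1
  obtain ⟨a, b, h, -, hxa⟩ := exists_isBranch ha hN hx
  have hx0 := E.pos hxa
  have hxN := h.lt_N hxa
  have hA : 0 < (N : ℝ) + x * y := by positivity
  have hB : 0 < (N : ℝ) + x * y' := by positivity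
  have key : thetaFun N (x, y) - thetaFun N (x, y')
      = N * x ^ 2 * (y' - y) / ((N + x * y) * (N + x * y')) := by
    rw [thetaFun, thetaFun, div_sub_div _ _ hA.ne' hB.ne']
    congr 1
    ring
  rw [key, abs_div, abs_mul, abs_of_pos (by positivity : (0 : ℝ) < N * x ^ 2),
    abs_of_pos (by positivity : 0 < ((N : ℝ) + x * y) * (N + x * y')), abs_sub_comm y' y,
    div_le_iff₀ (by positivity)]
  have h1 : (N : ℝ) * x ^ 2 ≤ N * N ^ 2 := by gcongr
  have h2 : (N : ℝ) * N ≤ (N + x * y) * (N + x * y') := by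
    gcongr
    · exact le_add_of_nonneg_right (by positivity)
    · exact le_add_of_nonneg_right (by positivity)
  calc (N : ℝ) * x ^ 2 * |y - y'| ≤ N * N ^ 2 * |y - y'| := by gcongr
    _ = N * |y - y'| * (N * N) := by ring
    _ ≤ _ := by gcongr

/-! ### Sublevel sets of the approximation coefficient -/

/-- One of the two rectangles that make up `X`. -/
def strip (a b : ℕ) : Set (ℝ × ℝ) := I a ×ˢ Set.Icc (b : ℝ) (b + 1)

lemma X_eq : X a₁ a₂ = strip a₁ a₂ ∪ strip a₂ a₁ := rfl

lemma measurableSet_strip : MeasurableSet (strip a b) := measurableSet_Ico.prod measurableSet_Icc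

lemma measurableSet_X : MeasurableSet (X a₁ a₂) := measurableSet_strip.union measurableSet_strip

lemma measurable_density : Measurable (density N) := by
  unfold density
  fun_prop

lemma measurable_thetaFun : Measurable (thetaFun N) := by
  unfold thetaFun
  fun_prop

lemma volume_strip : volume (strip a b) = 1 := by
  rw [strip, I, Measure.volume_eq_prod, Measure.prod_prod]
  simp

lemma mul_nonneg_of_mem_strip (hz : z ∈ strip a b) : 0 ≤ z.1 * z.2 :=
  mul_nonneg (a.cast_nonneg.trans hz.1.1) (b.cast_nonneg.trans hz.2.1)

lemma density_nonneg (z : ℝ × ℝ) : 0 ≤ density N z := by unfold density; positivity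

lemma density_pos (hN : 0 < N) (hz : 0 ≤ z.1 * z.2) : 0 < density N z := by
  have : (0 : ℝ) < N := by exact_mod_cast hN
  unfold density; positivity

lemma density_le (hN : 0 < N) (hz : 0 ≤ z.1 * z.2) : density N z ≤ 1 / N := by
  have : (0 : ℝ) < N := by exact_mod_cast hN
  rw [density, div_le_div_iff₀ (by positivity) this]
  nlinarith

lemma integrableOn_density (hN : 0 < N) : IntegrableOn (density N) (strip a b) := by
  refine Measure.integrableOn_of_bounded (M := 1 / N) (by rw [volume_strip]; simp)
    measurable_density.aestronglyMeasurable ?_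
  refine (ae_restrict_iff' measurableSet_strip).2 (ae_of_all _ fun z hz => ?_)
  rw [Real.norm_of_nonneg (density_nonneg z)]
  exact density_le hN (mul_nonneg_of_mem_strip hz)

/-- The unnormalised mass of the part of one rectangle on which `N x / (N + x y) ≤ c`. -/
def stripMass (N a b : ℕ) (c : ℝ) : ℝ :=
  ∫ z in strip a b ∩ {z | thetaFun N z ≤ c}, density N z

/-- The integral of the density over the part of a vertical segment where
`N x / (N + x y) ≤ c`. -/
def sliceMass (N b : ℕ) (c x : ℝ) : ℝ :=
  ∫ y in Set.Icc (b : ℝ) (b + 1), {z | thetaFun N z ≤ c}.indicator (density N) (x, y)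

lemma measurableSet_thetaFun_le : MeasurableSet {z | thetaFun N z ≤ c} :=
  measurableSet_le measurable_thetaFun measurable_const

lemma integrableOn_indicator (hN : 0 < N) :
    IntegrableOn ({z | thetaFun N z ≤ c}.indicator (density N)) (strip a b) :=
  (integrableOn_density hN).indicator measurableSet_thetaFun_le

lemma intervalIntegrable_sliceMass (hN : 0 < N) :
    IntervalIntegrable (sliceMass N b c) volume a (a + 1) := by
  have h := integrableOn_indicator (c := c) (a := a) (b := b) hN
  rw [strip, IntegrableOn, Measure.volume_eq_prod, ← Measure.prod_restrict] at h
  have h' : IntegrableOn (sliceMass N b c) (I a) := h.integral_prod_left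
  rw [intervalIntegrable_iff_integrableOn_Ico_of_le (by linarith)]
  exact h'

lemma stripMass_eq_integral (hN : 0 < N) :
    stripMass N a b c = ∫ x in (a : ℝ)..(a + 1), sliceMass N b c x := by
  have h := integrableOn_indicator (c := c) (a := a) (b := b) hN
  rw [strip, Measure.volume_eq_prod] at h
  rw [stripMass, ← setIntegral_indicator measurableSet_thetaFun_le, strip,
    Measure.volume_eq_prod, setIntegral_prod _ h,
    intervalIntegral.integral_of_le (by linarith), ← integral_Ico_eq_integral_Ioc]
  rfl

lemma add_mul_pos (hN : 0 < N) (hx : 0 < x) (hy : 0 ≤ y) : 0 < (N : ℝ) + x * y := by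
  have : (0 : ℝ) < N := by exact_mod_cast hN
  positivity

/-- For fixed `x` the density has the primitive `y / (N + x y)`. -/
lemma integral_density_slice {l r : ℝ} (hN : 0 < N) (hx : 0 < x) (hl : 0 ≤ l) (hlr : l ≤ r) :
    ∫ y in Set.Icc l r, density N (x, y) = r / (N + x * r) - l / (N + x * l) := by
  rw [integral_Icc_eq_integral_Ioc, ← intervalIntegral.integral_of_le hlr]
  have hpos : ∀ y ∈ Set.uIcc l r, (N : ℝ) + x * y ≠ 0 := fun y hy => by
    rw [Set.uIcc_of_le hlr] at hy
    exact (add_mul_pos hN hx (hl.trans hy.1)).ne'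
  refine intervalIntegral.integral_eq_sub_of_hasDerivAt (f := fun y => y / (N + x * y)) ?_ ?_
  · intro y hy
    have := (hasDerivAt_id y).div (((hasDerivAt_id y).const_mul x).const_add (N : ℝ)) (hpos y hy)
    refine this.congr_deriv ?_
    simp only [density, id]
    congr 1
    ring
  · refine ContinuousOn.intervalIntegrable ?_
    unfold density
    exact continuousOn_const.div (by fun_prop) fun y hy => pow_ne_zero 2 (hpos y hy)

lemma sliceMass_eq {l : ℝ} (hN : 0 < N) (hx : 0 < x) (hbl : b ≤ l) (hlb : l ≤ b + 1)
    (h : ∀ y : ℝ, b ≤ y → (l ≤ y ↔ N * x ≤ c * (N + x * y))) :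
    sliceMass N b c x = (b + 1) / (N + x * (b + 1)) - l / (N + x * l) := by
  have hb : (0 : ℝ) ≤ b := b.cast_nonneg
  rw [← integral_density_slice hN hx (hb.trans hbl) hlb, sliceMass,
    show Set.Icc l ((b : ℝ) + 1) = Set.Icc (b : ℝ) (b + 1) ∩ Set.Ici l by
      ext y; simp only [Set.mem_Icc, Set.mem_inter_iff, Set.mem_Ici]
      constructor
      · rintro ⟨h1, h2⟩; exact ⟨⟨hbl.trans h1, h2⟩, h1⟩
      · rintro ⟨⟨_, h2⟩, h1⟩; exact ⟨h1, h2⟩,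
    ← setIntegral_indicator measurableSet_Ici]
  refine setIntegral_congr_fun measurableSet_Icc fun y hy => ?_
  have hiff : (x, y) ∈ {z | thetaFun N z ≤ c} ↔ y ∈ Set.Ici l := by
    rw [Set.mem_Ici, h y hy.1]
    exact div_le_iff₀ (add_mul_pos hN hx (hb.trans hy.1))
  simp only [Set.indicator, hiff]

lemma sliceMass_of_le (hN : 0 < N) (hx : 0 < x) (h : N * x ≤ c * (N + x * b)) :
    sliceMass N b c x = (b + 1) / (N + x * (b + 1)) - b / (N + x * b) := by
  have hN0 : (0 : ℝ) < N := by exact_mod_cast hN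
  refine sliceMass_eq hN hx le_rfl (by linarith) fun y hy => ⟨fun _ => h.trans ?_, fun _ => hy⟩
  have : 0 ≤ c := by
    by_contra hc
    have := add_mul_pos hN hx b.cast_nonneg
    have : 0 < N * x := by positivity
    nlinarith
  gcongr

lemma sliceMass_of_mem (hN : 0 < N) (hx : 0 < x) (hc : 0 < c) (h1 : c * (N + x * b) ≤ N * x)
    (h2 : N * x ≤ c * (N + x * (b + 1))) :
    sliceMass N b c x = (b + 1) / (N + x * (b + 1)) - 1 / x + c / x ^ 2 := by
  have hN0 : (0 : ℝ) < N := by exact_mod_cast hN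
  have hcx : 0 < c * x := by positivity
  rw [sliceMass_eq (l := (N * x - c * N) / (c * x)) hN hx]
  · have e : (N : ℝ) + x * ((N * x - c * N) / (c * x)) = N * x / c := by
      field_simp; ring
    rw [e]
    field_simp
    ring
  · rw [le_div_iff₀ hcx]; linarith
  · rw [div_le_iff₀ hcx]; linarith
  · intro y _
    rw [div_le_iff₀ hcx]
    constructor <;> intro h <;> linarith

lemma sliceMass_of_lt (hN : 0 < N) (hx : 0 < x) (h : c * (N + x * (b + 1)) < N * x) :
    sliceMass N b c x = 0 := by
  have hN0 : (0 : ℝ) < N := by exact_mod_cast hN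
  have hb : (0 : ℝ) ≤ b := b.cast_nonneg
  rw [sliceMass]
  refine setIntegral_eq_zero_of_forall_eq_zero fun y hy => ?_
  refine Set.indicator_of_notMem (fun hmem => ?_) _
  have h0 := add_mul_pos hN hx (hb.trans hy.1)
  have hmem' : N * x ≤ c * (N + x * y) := (div_le_iff₀ h0).1 hmem
  have hc : 0 < c := by
    by_contra hc
    have : 0 < N * x := by positivity
    nlinarith
  have : c * (N + x * y) ≤ c * (N + x * (b + 1)) := by
    gcongr
    exact hy.2
  linarith

/-- The mass of a sublevel set in one rectangle, when the vertical slices are full up to `u`,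
partial from `u` to `v`, and empty from `v` on. If `a = 0` and `u = 0`, then `u = v`, and the terms
`log u` and `c / u` cancel. -/
lemma stripMass_eq {u v : ℝ} (hN : 0 < N) (hau : a ≤ u) (huv : u ≤ v) (hva : v ≤ a + 1)
    (hu : 0 < u ∨ u = v) (hc : u < v → 0 < c)
    (h1 : ∀ x ∈ Set.Ioo (a : ℝ) u, N * x ≤ c * (N + x * b))
    (h2 : ∀ x ∈ Set.Ioo u v, c * (N + x * b) ≤ N * x ∧ N * x ≤ c * (N + x * (b + 1)))
    (h3 : ∀ x ∈ Set.Ioo v (a + 1), c * (N + x * (b + 1)) < N * x) :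
    stripMass N a b c =
      (Real.log (N + u * (b + 1)) - Real.log (N + u * b)
        - (Real.log (N + a * (b + 1)) - Real.log (N + a * b)))
      + (Real.log (N + v * (b + 1)) - Real.log v - c / v
        - (Real.log (N + u * (b + 1)) - Real.log u - c / u)) := by
  have hN0 : (0 : ℝ) < N := by exact_mod_cast hN
  have hb : (0 : ℝ) ≤ b := b.cast_nonneg
  have ha : (0 : ℝ) ≤ a := a.cast_nonneg
  have hint := intervalIntegrable_sliceMass (a := a) (b := b) (c := c) hN
  have hsub : ∀ {r s : ℝ}, a ≤ r → r ≤ s → s ≤ a + 1 →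
      IntervalIntegrable (sliceMass N b c) volume r s := fun hr hrs hs =>
    hint.mono_set (by
      rw [Set.uIcc_of_le hrs, Set.uIcc_of_le (by linarith)]
      exact Set.Icc_subset_Icc hr hs)
  have i1 := hsub le_rfl hau (huv.trans hva)
  have i2 := hsub hau huv hva
  have i3 := hsub (hau.trans huv) hva le_rfl
  have hlog : ∀ {k x : ℝ}, 0 ≤ k → 0 ≤ x →
      HasDerivAt (fun x => Real.log (N + x * k)) (k / (N + x * k)) x := by
    intro k x hk hx
    have := (((hasDerivAt_id x).mul_const k).const_add (N : ℝ)).log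
      (by simp only [id]; positivity)
    simpa using this
  have e1 := intervalIntegral.integral_eq_sub_of_hasDerivAt_of_le hau
    (f := fun x => Real.log (N + x * (b + 1)) - Real.log (N + x * b)) (f' := sliceMass N b c)
    (fun x hx => ((hlog (by linarith) (ha.trans hx.1)).sub
      (hlog hb (ha.trans hx.1))).continuousAt.continuousWithinAt)
    (fun x hx => by
      rw [sliceMass_of_le hN (ha.trans_lt hx.1) (h1 x hx)]
      exact (hlog (by linarith) (ha.trans hx.1.le)).sub (hlog hb (ha.trans hx.1.le))) i1
  have e2 : ∫ x in u..v, sliceMass N b c x = Real.log (N + v * (b + 1)) - Real.log v - c / v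
        - (Real.log (N + u * (b + 1)) - Real.log u - c / u) := by
    rcases eq_or_lt_of_le huv with rfl | hlt
    · simp
    have hu0 : 0 < u := hu.resolve_right hlt.ne
    have hder : ∀ x, 0 < x → HasDerivAt
        (fun x => Real.log (N + x * (b + 1)) - Real.log x - c / x)
        ((b + 1) / (N + x * (b + 1)) - 1 / x + c / x ^ 2) x := by
      intro x hx
      have h4 := (hasDerivAt_const x c).div (hasDerivAt_id x) hx.ne'
      have := ((hlog (k := b + 1) (by linarith) hx.le).sub (Real.hasDerivAt_log hx.ne')).sub h4
      refine this.congr_deriv ?_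
      simp only [id]
      ring
    exact intervalIntegral.integral_eq_sub_of_hasDerivAt_of_le huv
      (fun x hx => (hder x (hu0.trans_le hx.1)).continuousAt.continuousWithinAt)
      (fun x hx => by
        rw [sliceMass_of_mem hN (hu0.trans hx.1) (hc hlt) (h2 x hx).1 (h2 x hx).2]
        exact hder x (hu0.trans hx.1)) i2
  have e3 : ∫ x in v..(a + 1 : ℝ), sliceMass N b c x = 0 := by
    have := intervalIntegral.integral_eq_sub_of_hasDerivAt_of_le hva
      (f := fun _ => (0 : ℝ)) (f' := sliceMass N b c) continuousOn_const
      (fun x hx => by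
        rw [sliceMass_of_lt hN ((ha.trans (hau.trans huv)).trans_lt hx.1) (h3 x hx)]
        exact hasDerivAt_const _ _) i3
    simpa using this
  rw [stripMass_eq_integral hN, ← intervalIntegral.integral_add_adjacent_intervals i1 (i2.trans i3),
    ← intervalIntegral.integral_add_adjacent_intervals i2 i3, e1, e2, e3, add_zero]

lemma lt_root_iff {M k : ℝ} (h : 0 < M - k * c) :
    x < M * c / (M - k * c) ↔ M * x < c * (M + x * k) := by
  rw [lt_div_iff₀ h]
  constructor <;> intro h <;> linarith

lemma root_lt_iff {M k : ℝ} (h : 0 < M - k * c) :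
    M * c / (M - k * c) < x ↔ c * (M + x * k) < M * x := by
  rw [div_lt_iff₀ h]
  constructor <;> intro h <;> linarith

lemma log_add_root_mul {M k v : ℝ} (hM : 0 < M) (hc : 0 < c) (h : 0 < M - k * c)
    (hv : v = M * c / (M - k * c)) :
    Real.log (M + v * k) = Real.log M + Real.log v - Real.log c := by
  have hv0 : 0 < v := by rw [hv]; positivity
  have : M + v * k = M * v / c := by
    have hv' : v * (M - k * c) = M * c := by rw [hv, div_mul_cancel₀ _ h.ne']
    rw [eq_div_iff hc.ne']
    linear_combination -hv'
  rw [this, Real.log_div (by positivity) hc.ne', Real.log_mul hM.ne' hv0.ne']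

lemma stripMass_of_le (hN : 0 < N) (hc : c ≤ N * a / (N + a * (b + 1))) :
    stripMass N a b c = 0 := by
  have hN0 : (0 : ℝ) < N := by exact_mod_cast hN
  have ha : (0 : ℝ) ≤ a := a.cast_nonneg
  have hb : (0 : ℝ) ≤ b := b.cast_nonneg
  rw [le_div_iff₀ (by positivity)] at hc
  have hD : 0 < N - (b + 1) * c := by
    by_contra hD
    push Not at hD
    have : 0 < c := by
      by_contra hc'
      nlinarith
    nlinarith [mul_pos this hN0]
  rw [stripMass_eq (u := a) (v := a) hN le_rfl le_rfl (by linarith) (Or.inr rfl) (by simp)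
    (by simp) (by simp)]
  · ring
  · intro x hx
    nlinarith [hx.1]

lemma stripMass_of_mem_first (hN : 0 < N) (hle : (a : ℝ) * (a + 1) ≤ N)
    (hc : c ∈ Set.Ioc ((N : ℝ) * a / (N + a * (b + 1))) ((N : ℝ) * a / (N + a * b))) :
    stripMass N a b c = c * (b + 1 + (N : ℝ) / a) / N - 1
      - Real.log ((N * c + c * a * (b + 1)) / (a * N)) := by
  have hN0 : (0 : ℝ) < N := by exact_mod_cast hN
  have ha : (0 : ℝ) ≤ a := a.cast_nonneg
  have hb : (0 : ℝ) ≤ b := b.cast_nonneg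
  obtain ⟨hc1, hc2⟩ := hc
  have hc0 : 0 < c := lt_of_le_of_lt (by positivity) hc1
  have ha0 : (0 : ℝ) < a := by
    refine lt_of_le_of_ne ha fun h => ?_
    rw [← h] at hc2
    simp at hc2
    linarith
  rw [div_lt_iff₀ (by positivity)] at hc1
  rw [le_div_iff₀ (by positivity)] at hc2
  have hD0 : 0 < N - b * c := by nlinarith
  have hD : c * N ≤ (a + 1) * (N - (b + 1) * c) := by
    have h1 : (a : ℝ) * c ≤ N * a * a / (N + a * b) := by
      rw [le_div_iff₀ (by positivity)]; nlinarith
    have h2 : c * (N + (a + 1) * (b + 1)) * (N + a * b) ≤ (a + 1) * N * (N + a * b) := by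
      calc c * (N + (a + 1) * (b + 1)) * (N + a * b)
          = (c * (N + a * b)) * (N + (a + 1) * (b + 1)) := by ring
        _ ≤ N * a * (N + (a + 1) * (b + 1)) := by gcongr
        _ ≤ (a + 1) * N * (N + a * b) := by nlinarith
    have := le_of_mul_le_mul_right h2 (by positivity)
    linarith
  have hD1 : 0 < N - (b + 1) * c := by
    have : 0 < c * N := by positivity
    exact pos_of_mul_pos_right (this.trans_le hD) (by linarith)
  obtain ⟨v, hv⟩ : ∃ v, v = N * c / (N - (b + 1) * c) := ⟨_, rfl⟩
  have hav : a < v := by rw [hv, lt_root_iff hD1]; linarith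
  have hva : v ≤ a + 1 := by rw [hv, div_le_iff₀ hD1]; linarith
  have hv0 : 0 < v := ha0.trans hav
  rw [stripMass_eq (u := a) (v := v) hN le_rfl hav.le hva (Or.inl ha0) (fun _ => hc0)
    (by simp)]
  · rw [log_add_root_mul hN0 hc0 hD1 hv,
      show N * c + c * a * (b + 1) = c * (N + a * (b + 1)) by ring,
      Real.log_div (by positivity) (by positivity), Real.log_mul (by positivity) (by positivity),
      Real.log_mul (by positivity) (by positivity),
      show c / v = (N - (b + 1) * c) / N by rw [hv]; field_simp]
    field_simp
    ring
  · intro x hx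
    have := hx.1
    refine ⟨by nlinarith, ?_⟩
    have := hx.2
    rw [hv, lt_root_iff hD1] at this
    exact this.le
  · intro x hx
    have := hx.1
    rwa [hv, root_lt_iff hD1] at this

lemma stripMass_of_mem_second (hN : 0 < N)
    (hc : c ∈ Set.Ioc ((N : ℝ) * a / (N + a * b))
      ((N : ℝ) * (a + 1) / (N + (a + 1) * (b + 1)))) :
    stripMass N a b c =
      -Real.log (((N : ℝ) + a * (b + 1)) / (N + a * b)) + c / N := by
  have hN0 : (0 : ℝ) < N := by exact_mod_cast hN
  have ha : (0 : ℝ) ≤ a := a.cast_nonneg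
  have hb : (0 : ℝ) ≤ b := b.cast_nonneg
  obtain ⟨hc1, hc2⟩ := hc
  have hc0 : 0 < c := lt_of_le_of_lt (by positivity) hc1
  rw [div_lt_iff₀ (by positivity)] at hc1
  rw [le_div_iff₀ (by positivity)] at hc2
  have hD1 : 0 < N - (b + 1) * c := by
    have : 0 < c * N := by positivity
    have h2 : c * N ≤ (a + 1) * (N - (b + 1) * c) := by linarith
    exact pos_of_mul_pos_right (this.trans_le h2) (by linarith)
  have hD0 : 0 < N - b * c := by linarith
  -- Slices are full to the left of `u` and empty to the right of `v`.
  obtain ⟨u, hu⟩ : ∃ u, u = N * c / (N - b * c) := ⟨_, rfl⟩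
  obtain ⟨v, hv⟩ : ∃ v, v = N * c / (N - (b + 1) * c) := ⟨_, rfl⟩
  have hau : a < u := by rw [hu, lt_root_iff hD0]; linarith
  have hva : v ≤ a + 1 := by rw [hv, div_le_iff₀ hD1]; linarith
  have huv : u ≤ v := by
    rw [hu, hv]
    gcongr
    linarith
  have hu0 : 0 < u := ha.trans_lt hau
  have hv0 : 0 < v := hu0.trans_le huv
  rw [stripMass_eq (u := u) (v := v) hN hau.le huv hva (Or.inl hu0) (fun _ => hc0)]
  · rw [log_add_root_mul hN0 hc0 hD1 hv, log_add_root_mul hN0 hc0 hD0 hu,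
      Real.log_div (by positivity) (by positivity),
      show c / v = (N - (b + 1) * c) / N by rw [hv]; field_simp,
      show c / u = (N - b * c) / N by rw [hu]; field_simp]
    field_simp
    ring
  · intro x hx
    have := hx.2
    rw [hu, lt_root_iff hD0] at this
    exact this.le
  · intro x hx
    have h1 := hx.1
    have h2 := hx.2
    rw [hu, root_lt_iff hD0] at h1
    rw [hv, lt_root_iff hD1] at h2
    exact ⟨h1.le, h2.le⟩
  · intro x hx
    have := hx.1
    rwa [hv, root_lt_iff hD1] at this

lemma stripMass_of_mem_third (hN : 0 < N) (hle : (a : ℝ) * (a + 1) ≤ N)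
    (hc : c ∈ Set.Ioc ((N : ℝ) * (a + 1) / (N + (a + 1) * (b + 1)))
      ((N : ℝ) * (a + 1) / (N + b * (a + 1)))) :
    stripMass N a b c =
      Real.log ((N * c + c * (a + 1) * (b + 1)) / (N * (a + 1))
        * (((N : ℝ) + a * b) / (N + a * (b + 1)))) + 1 - c / (a + 1) - c * b / N := by
  have hN0 : (0 : ℝ) < N := by exact_mod_cast hN
  have ha : (0 : ℝ) ≤ a := a.cast_nonneg
  have hb : (0 : ℝ) ≤ b := b.cast_nonneg
  obtain ⟨hc1, hc2⟩ := hc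
  have hc0 : 0 < c := lt_of_le_of_lt (by positivity) hc1
  rw [div_lt_iff₀ (by positivity)] at hc1
  rw [le_div_iff₀ (by positivity)] at hc2
  have hD0 : 0 < N - b * c := by
    have : 0 < c * N := by positivity
    have h2 : c * N ≤ (a + 1) * (N - b * c) := by linarith
    exact pos_of_mul_pos_right (this.trans_le h2) (by linarith)
  obtain ⟨u, hu⟩ : ∃ u, u = N * c / (N - b * c) := ⟨_, rfl⟩
  have hau : a < u := by
    rw [hu, lt_root_iff hD0]
    have h2 : N * a * (N + (a + 1) * (b + 1)) < c * (N + a * b) * (N + (a + 1) * (b + 1)) := by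
      calc (N : ℝ) * a * (N + (a + 1) * (b + 1)) ≤ N * (a + 1) * (N + a * b) := by nlinarith
        _ < c * (N + (a + 1) * (b + 1)) * (N + a * b) := by gcongr
        _ = _ := by ring
    exact lt_of_mul_lt_mul_right h2 (by positivity)
  have hua : u ≤ a + 1 := by rw [hu, div_le_iff₀ hD0]; linarith
  have hu0 : 0 < u := ha.trans_lt hau
  rw [stripMass_eq (u := u) (v := a + 1) hN hau.le hua le_rfl (Or.inl hu0) (fun _ => hc0)]
  · rw [log_add_root_mul hN0 hc0 hD0 hu,
      show N * c + c * (a + 1) * (b + 1) = c * (N + (a + 1) * (b + 1)) by ring,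
      Real.log_mul (by positivity) (by positivity),
      Real.log_div (by positivity) (by positivity), Real.log_div (by positivity) (by positivity),
      Real.log_mul (by positivity) (by positivity), Real.log_mul (by positivity) (by positivity),
      show c / u = (N - b * c) / N by rw [hu]; field_simp]
    field_simp
    ring
  · intro x hx
    have := hx.2
    rw [hu, lt_root_iff hD0] at this
    exact this.le
  · intro x hx
    have h1 := hx.1
    rw [hu, root_lt_iff hD0] at h1
    refine ⟨h1.le, ?_⟩
    have h2 := hx.2
    rcases le_or_gt (N - (b + 1) * c) 0 with h | h <;> nlinarith [mul_pos hc0 hN0, hx.1]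
  · simp

/-- The mass of a whole rectangle. It is symmetric in `a` and `b`, which is why both rectangles
of `X` have the same mass. -/
def fullMass (N a b : ℕ) : ℝ :=
  Real.log (N + (a + 1) * (b + 1)) - Real.log (N + (a + 1) * b)
    - (Real.log (N + a * (b + 1)) - Real.log (N + a * b))

lemma fullMass_symm : fullMass N a b = fullMass N b a := by
  simp only [fullMass, mul_comm]
  ring

lemma stripMass_of_ge (hN : 0 < N) (hc : (N : ℝ) * (a + 1) / (N + b * (a + 1)) ≤ c) :
    stripMass N a b c = fullMass N a b := by
  have hN0 : (0 : ℝ) < N := by exact_mod_cast hN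
  have ha : (0 : ℝ) ≤ a := a.cast_nonneg
  have hb : (0 : ℝ) ≤ b := b.cast_nonneg
  have hc0 : 0 < c := lt_of_lt_of_le (by positivity) hc
  rw [div_le_iff₀ (by positivity)] at hc
  rw [stripMass_eq (u := a + 1) (v := a + 1) hN (by linarith) le_rfl le_rfl (Or.inr rfl)
    (fun _ => hc0) _ (by simp) (by simp)]
  · rw [fullMass]; ring
  · intro x hx
    have h2 := hx.2
    rcases le_or_gt (N - b * c) 0 with h | h <;> nlinarith [mul_pos hc0 hN0, hx.1]

lemma fullMass_eq_log (hN : 0 < N) :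
    fullMass N a b = Real.log (1 + (N : ℝ) / ((N + a * (b + 1)) * (N + b * (a + 1)))) := by
  have hN0 : (0 : ℝ) < N := by exact_mod_cast hN
  have e : 1 + (N : ℝ) / ((N + a * (b + 1)) * (N + b * (a + 1)))
      = ((N + (a + 1) * (b + 1)) / (N + (a + 1) * b)) / ((N + a * (b + 1)) / (N + a * b)) := by
    field_simp
    ring
  rw [e, Real.log_div (by positivity) (by positivity), Real.log_div (by positivity) (by positivity),
    Real.log_div (by positivity) (by positivity), fullMass]

lemma fullMass_pos (hN : 0 < N) : 0 < fullMass N a b := by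
  have hN0 : (0 : ℝ) < N := by exact_mod_cast hN
  rw [fullMass_eq_log hN]
  exact Real.log_pos (lt_add_of_pos_right _ (by positivity))

lemma integral_density_strip (hN : 0 < N) : ∫ z in strip a b, density N z = fullMass N a b := by
  have hN0 : (0 : ℝ) < N := by exact_mod_cast hN
  have hb : (0 : ℝ) ≤ b := b.cast_nonneg
  rw [← stripMass_of_ge (c := a + 1) hN, stripMass]
  · congr 2
    refine (Set.inter_eq_left.2 fun z hz => ?_).symm
    have h0 : (0 : ℝ) ≤ z.1 := a.cast_nonneg.trans hz.1.1
    have h1 := mul_nonneg_of_mem_strip hz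
    have h2 : z.1 ≤ a + 1 := hz.1.2.le
    change N * z.1 / (N + z.1 * z.2) ≤ a + 1
    rw [div_le_iff₀ (by positivity)]
    nlinarith [mul_nonneg h1 (h0.trans h2)]
  · rw [div_le_iff₀ (by positivity)]
    nlinarith [show (0 : ℝ) ≤ (a + 1) * (b * (a + 1)) by positivity]

lemma disjoint_strip (ha : a₁ < a₂) : Disjoint (strip a₁ a₂) (strip a₂ a₁) :=
  Set.disjoint_left.2 fun _ h1 h2 => I_disjoint ha h2.1 h1.1

lemma inv_C (ha : a₁ < a₂) (hN : 0 < N) : (C a₁ a₂ N)⁻¹ = 2 * fullMass N a₁ a₂ := by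
  rw [C, inv_inv, X_eq, setIntegral_union (disjoint_strip ha) measurableSet_strip
    (integrableOn_density hN) (integrableOn_density hN), integral_density_strip hN,
    integral_density_strip hN, fullMass_symm (a := a₂)]
  ring

lemma C_pos (ha : a₁ < a₂) (hN : 0 < N) : 0 < C a₁ a₂ N := by
  rw [← inv_pos, inv_C ha hN]
  have := fullMass_pos (a := a₁) (b := a₂) hN
  positivity

lemma C_mul_fullMass (ha : a₁ < a₂) (hN : 0 < N) :
    C a₁ a₂ N * fullMass N a₁ a₂ = 1 / 2 := by
  have h := inv_C ha hN
  have hC := C_pos ha hN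
  have : C a₁ a₂ N * (C a₁ a₂ N)⁻¹ = 1 := mul_inv_cancel₀ hC.ne'
  rw [h] at this
  linarith

lemma muBar_apply_of_subset (ha : a₁ < a₂) (hN : 0 < N) {s : Set (ℝ × ℝ)} (hs : MeasurableSet s)
    (hsX : s ⊆ X a₁ a₂) :
    muBar a₁ a₂ N s = ENNReal.ofReal (C a₁ a₂ N * ∫ z in s, density N z) := by
  have hint : IntegrableOn (density N) (X a₁ a₂) :=
    (integrableOn_density hN).union (integrableOn_density hN)
  rw [muBar, withDensity_apply _ hs, Measure.restrict_restrict hs,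
    Set.inter_eq_left.2 hsX, ← integral_const_mul, ofReal_integral_eq_lintegral_ofReal]
  · exact (hint.mono_set hsX).const_mul _
  · exact ae_of_all _ fun z => mul_nonneg (C_pos ha hN).le (density_nonneg z)

lemma measurableSet_A : MeasurableSet (A a₁ a₂ N c) :=
  measurableSet_X.inter measurableSet_thetaFun_le

lemma F_eq (ha : a₁ < a₂) (hN : 0 < N) (c : ℝ) :
    F a₁ a₂ N c = C a₁ a₂ N * (stripMass N a₁ a₂ c + stripMass N a₂ a₁ c) := by
  have hA : A a₁ a₂ N c = strip a₁ a₂ ∩ {z | thetaFun N z ≤ c}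
      ∪ strip a₂ a₁ ∩ {z | thetaFun N z ≤ c} := by
    rw [← Set.union_inter_distrib_right]; rfl
  rw [F, muBar_apply_of_subset ha hN measurableSet_A (fun z hz => hz.1), ENNReal.toReal_ofReal
    (mul_nonneg (C_pos ha hN).le (integral_nonneg density_nonneg)), hA,
    setIntegral_union ((disjoint_strip ha).mono Set.inter_subset_left Set.inter_subset_left)
      (measurableSet_strip.inter measurableSet_thetaFun_le)
      ((integrableOn_density hN).mono_set Set.inter_subset_left)
      ((integrableOn_density hN).mono_set Set.inter_subset_left)]
  rfl

lemma isProbabilityMeasure_muBar (ha : a₁ < a₂) (hN : 0 < N) :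
    IsProbabilityMeasure (muBar a₁ a₂ N) := by
  have h1 : muBar a₁ a₂ N (X a₁ a₂) = 1 := by
    rw [muBar_apply_of_subset ha hN measurableSet_X subset_rfl]
    have : C a₁ a₂ N * (∫ z in X a₁ a₂, density N z) = 1 :=
      inv_mul_cancel₀ fun h => (C_pos ha hN).ne' (by rw [C, h, inv_zero])
    rw [this, ENNReal.ofReal_one]
  have h2 : muBar a₁ a₂ N (X a₁ a₂)ᶜ = 0 := by
    refine withDensity_absolutelyContinuous _ _ ?_
    rw [Measure.restrict_apply measurableSet_X.compl, Set.compl_inter_self, measure_empty]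
  refine ⟨?_⟩
  rw [← Set.union_compl_self (X a₁ a₂), measure_union disjoint_compl_right measurableSet_X.compl,
    h1, h2, add_zero]

/-! ### Invariant measures -/

lemma measurableSet_E : MeasurableSet (E a) :=
  (Set.countable_range _).measurableSet.compl.inter measurableSet_Ioo

lemma measurableSet_OmegaIrr : MeasurableSet (OmegaIrr a₁ a₂) :=
  measurableSet_E.union measurableSet_E

lemma measurableSet_G : MeasurableSet (G a₁ a₂) :=
  (measurableSet_E.prod measurableSet_E).union (measurableSet_E.prod measurableSet_E)

lemma ae_irrational : ∀ᵐ x : ℝ, Irrational x := (Set.countable_range _).ae_notMem volume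

lemma mem_E_of_irrational (hx : Irrational x) (h : x ∈ Set.Icc (a : ℝ) (a + 1)) : x ∈ E a :=
  ⟨hx, lt_of_le_of_ne h.1 (hx.ne_nat a).symm, lt_of_le_of_ne h.2 (by
    have := hx.ne_nat (a + 1)
    push_cast at this
    exact this)⟩

lemma volume_E : volume (E a) = 1 := by
  have h : E a =ᵐ[volume] Set.Icc (a : ℝ) (a + 1) := by
    filter_upwards [ae_irrational] with x hx
    exact propext ⟨fun h => ⟨h.2.1.le, h.2.2.le⟩, mem_E_of_irrational hx⟩
  rw [measure_congr h]
  simp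

lemma X_ae_eq_G : X a₁ a₂ =ᵐ[volume] G a₁ a₂ := by
  have h1 : ∀ᵐ z : ℝ × ℝ, Irrational z.1 :=
    Measure.quasiMeasurePreserving_fst.ae ae_irrational
  have h2 : ∀ᵐ z : ℝ × ℝ, Irrational z.2 :=
    Measure.quasiMeasurePreserving_snd.ae ae_irrational
  filter_upwards [h1, h2] with z hz1 hz2
  refine propext ⟨fun h => ?_, fun h => ?_⟩
  · refine h.imp ?_ ?_ <;> exact fun h => ⟨mem_E_of_irrational hz1 ⟨h.1.1, h.1.2.le⟩,
      mem_E_of_irrational hz2 h.2⟩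
  · refine h.imp ?_ ?_ <;> exact fun h => ⟨E_subset_I h.1, h.2.2.1.le, h.2.2.2.le⟩

lemma muBar_eq : muBar a₁ a₂ N = (volume.restrict (G a₁ a₂)).withDensity
    fun z => ENNReal.ofReal (C a₁ a₂ N * density N z) := by
  rw [muBar, Measure.restrict_congr_set X_ae_eq_G]

lemma measurable_muBar_density :
    Measurable fun z => ENNReal.ofReal (C a₁ a₂ N * density N z) :=
  (measurable_density.const_mul _).ennreal_ofReal

/-- The natural extension is a bijection of `G` with a Jacobian that the density compensates. -/
lemma measurePreserving_natExt (ha : a₁ < a₂) (hN : IsSimple a₁ a₂ N) :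
    MeasurePreserving (natExt a₁ a₂ N) (muBar a₁ a₂ N) (muBar a₁ a₂ N) := by
  refine ⟨measurable_natExt, Measure.ext fun B hB => ?_⟩
  have hB' := measurable_natExt (a₁ := a₁) (a₂ := a₂) (N := N) hB
  rw [Measure.map_apply measurable_natExt hB, muBar_eq, withDensity_apply _ hB',
    withDensity_apply _ hB, ← lintegral_indicator hB', ← lintegral_indicator hB]
  have hcov := lintegral_image_eq_lintegral_abs_det_fderiv_mul volume measurableSet_G
    (fun z hz => (hasFDerivAt_natExt ha hN hz).hasFDerivWithinAt) (injOn_natExt ha hN)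
    (B.indicator fun z => ENNReal.ofReal (C a₁ a₂ N * density N z))
  rw [image_natExt ha hN] at hcov
  rw [hcov]
  refine setLIntegral_congr_fun measurableSet_G fun z hz => ?_
  by_cases hzB : natExt a₁ a₂ N z ∈ B
  · simp only [Set.indicator, hzB, Set.mem_preimage, if_true]
    rw [← ENNReal.ofReal_mul (abs_nonneg _), ← abs_det_mul_density ha hN hz]
    congr 1
    ring
  · simp [Set.indicator, hzB]

/-- The `T`-invariant measure, the first marginal of `μ̄`. -/
def invMeasure (a₁ a₂ N : ℕ) : Measure ℝ := (muBar a₁ a₂ N).map Prod.fst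

lemma isProbabilityMeasure_invMeasure (ha : a₁ < a₂) (hN : 0 < N) :
    IsProbabilityMeasure (invMeasure a₁ a₂ N) :=
  have := isProbabilityMeasure_muBar ha hN
  Measure.isProbabilityMeasure_map measurable_fst.aemeasurable

lemma measurePreserving_T (ha : a₁ < a₂) (hN : IsSimple a₁ a₂ N) :
    MeasurePreserving (T a₁ a₂ N) (invMeasure a₁ a₂ N) (invMeasure a₁ a₂ N) :=
  MeasurePreserving.of_semiconj ⟨measurable_fst, rfl⟩ (measurePreserving_natExt ha hN)
    (fun _ => rfl) measurable_T

/-- The invariant measure has the null sets of Lebesgue measure on `Ω`. -/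
lemma invMeasure_eq_zero_iff (ha : a₁ < a₂) (hN : 0 < N) {B : Set ℝ} (hB : MeasurableSet B) :
    invMeasure a₁ a₂ N B = 0 ↔ volume (OmegaIrr a₁ a₂ ∩ B) = 0 := by
  have hBm : MeasurableSet (Prod.fst ⁻¹' B : Set (ℝ × ℝ)) := measurable_fst hB
  have hset : ({z | ENNReal.ofReal (C a₁ a₂ N * density N z) ≠ 0} ∩ Prod.fst ⁻¹' B) ∩ G a₁ a₂
      = (E a₁ ∩ B) ×ˢ E a₂ ∪ (E a₂ ∩ B) ×ˢ E a₁ := by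
    ext z
    constructor
    · rintro ⟨⟨_, hz⟩, h | h⟩
      · exact Or.inl ⟨⟨h.1, hz⟩, h.2⟩
      · exact Or.inr ⟨⟨h.1, hz⟩, h.2⟩
    · rintro (h | h)
      · exact ⟨⟨(ENNReal.ofReal_pos.2 (mul_pos (C_pos ha hN) (density_pos hN
          (mul_pos (E.pos h.1.1) (E.pos h.2)).le))).ne', h.1.2⟩, Or.inl ⟨h.1.1, h.2⟩⟩
      · exact ⟨⟨(ENNReal.ofReal_pos.2 (mul_pos (C_pos ha hN) (density_pos hN
          (mul_pos (E.pos h.1.1) (E.pos h.2)).le))).ne', h.1.2⟩, Or.inr ⟨h.1.1, h.2⟩⟩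
  rw [invMeasure, Measure.map_apply measurable_fst hB, muBar_eq,
    withDensity_apply_eq_zero measurable_muBar_density, Measure.restrict_apply' measurableSet_G,
    hset, measure_union_null_iff, Measure.volume_eq_prod, Measure.prod_prod, Measure.prod_prod,
    volume_E, volume_E, mul_one, mul_one, OmegaIrr, Set.union_inter_distrib_right,
    measure_union_null_iff]

/-! ### Ergodicity -/

/-- The inverse branches of the iterates of `T` have bounded distortion, so an invariant set
occupies a fixed proportion of arbitrarily small balls around every irrational point. -/
lemma le_volume_inter_closedBall (ha : a₁ < a₂) (hN : IsSimple a₁ a₂ N) {B : Set ℝ}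
    (hB : MeasurableSet B) (hTB : T a₁ a₂ N ⁻¹' B = B) {k : ENNReal}
    (h1 : k ≤ volume (E a₁ ∩ B)) (h2 : k ≤ volume (E a₂ ∩ B)) (hx : x ∈ OmegaIrr a₁ a₂) (n : ℕ) :
    ENNReal.ofReal ((N : ℝ) ^ (n + 1) / (q a₁ a₂ N x (n + 1) : ℝ) ^ 2 / (N + 1) ^ 2) * k ≤
      volume (B ∩ Metric.closedBall x ((N : ℝ) ^ (n + 1) / (q a₁ a₂ N x (n + 1) : ℝ) ^ 2)) := by
  have hTx := iterate_T_mem_OmegaIrr ha hN hx n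
  obtain ⟨a, b, h, h', hab⟩ := exists_isBranch ha hN hTx
  have hT := h.T_mem hab
  rw [← Function.iterate_succ_apply' (T a₁ a₂ N)] at hT
  have hk : k ≤ volume (E b ∩ B) := by
    rcases h.mem_OmegaIrr _ hT with hb | hb
    · obtain ⟨rfl, -⟩ := h'.unique (isBranch_left hN) hT hb
      exact h1
    · obtain ⟨rfl, -⟩ := h'.unique (isBranch_right ha hN) hT hb
      exact h2
  have hN0 := h.posR
  have hq0 := q_pos ha hN hx n
  have hq1 := q_pos ha hN hx (n + 1)
  have hqq := q_le_succ ha hN hx n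
  set Q := (q a₁ a₂ N x (n + 1) : ℝ)
  set Q' := (q a₁ a₂ N x n : ℝ)
  have hinv : ∀ t ∈ E b, (T a₁ a₂ N)^[n + 1] (mobius a₁ a₂ N x n t) = t := fun t ht =>
    iterate_T_mobius ha hN hx n h hab ht
  have hinj : Set.InjOn (mobius a₁ a₂ N x n) (E b ∩ B) := fun s hs t ht hst => by
    rw [← hinv s hs.1, hst, hinv t ht.1]
  have hcov := lintegral_image_eq_lintegral_abs_deriv_mul (measurableSet_E.inter hB)
    (fun t ht => (hasDerivAt_mobius ha hN hx n (E.pos ht.1).le).hasDerivWithinAt) hinj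
    (fun _ => 1)
  rw [setLIntegral_one] at hcov
  have hsub : mobius a₁ a₂ N x n '' (E b ∩ B) ⊆
      B ∩ Metric.closedBall x ((N : ℝ) ^ (n + 1) / Q ^ 2) := by
    rintro _ ⟨t, ht, rfl⟩
    constructor
    · have : mobius a₁ a₂ N x n t ∈ (T a₁ a₂ N)^[n + 1] ⁻¹' B := by
        rw [Set.mem_preimage, hinv t ht.1]
        exact ht.2
      rwa [(Function.IsFixedPt.preimage_iterate hTB (n + 1) : _ = _)] at this
    · rw [Metric.mem_closedBall, Real.dist_eq]
      have hm := mobius_sub_mobius ha hN hx n (E.pos ht.1).le (E.pos hT).le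
      rw [mobius_iterate_T ha hN hx n] at hm
      refine hm.trans (mul_le_of_le_one_right (by positivity) ?_)
      rw [abs_le]
      constructor <;> linarith [ht.1.2.1, ht.1.2.2, hT.2.1, hT.2.2]
  refine le_trans ?_ (measure_mono hsub)
  rw [hcov]
  refine (mul_le_mul_right hk _).trans ?_
  rw [← setLIntegral_const]
  refine setLIntegral_mono' (measurableSet_E.inter hB) fun t ht => ?_
  rw [mul_one]
  refine ENNReal.ofReal_le_ofReal ?_
  have ht0 := E.pos ht.1
  have htN := h'.lt_N ht.1
  rw [abs_div, abs_mul, abs_pow, abs_neg, abs_one, one_pow, one_mul,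
    abs_of_nonneg (by positivity : (0 : ℝ) ≤ (N : ℝ) ^ (n + 1)), abs_of_nonneg (sq_nonneg _),
    div_div, ← mul_pow]
  refine div_le_div_of_nonneg_left (by positivity) (by positivity) ?_
  gcongr
  nlinarith

lemma tendsto_radius (ha : a₁ < a₂) (hN : IsSimple a₁ a₂ N) (hx : x ∈ OmegaIrr a₁ a₂) :
    Tendsto (fun n => (N : ℝ) ^ (n + 1) / (q a₁ a₂ N x (n + 1) : ℝ) ^ 2) atTop (𝓝[>] 0) := by
  have hN0 : (0 : ℝ) < N := by exact_mod_cast hN.1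
  have hpos : ∀ n, 0 < (N : ℝ) ^ (n + 1) / (q a₁ a₂ N x (n + 1) : ℝ) ^ 2 := fun n => by
    have := q_pos ha hN hx (n + 1)
    positivity
  refine tendsto_nhdsWithin_iff.2 ⟨?_, Eventually.of_forall hpos⟩
  have hlim : Tendsto (fun n : ℕ => ((N : ℝ) + 1) * ((N : ℝ) / (N + 1)) ^ (n + 1)) atTop (𝓝 0) := by
    have := (tendsto_pow_atTop_nhds_zero_of_lt_one (r := (N : ℝ) / (N + 1)) (by positivity)
      (by rw [div_lt_one (by positivity)]; linarith)).comp (tendsto_add_atTop_nat 1)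
    simpa using this.const_mul ((N : ℝ) + 1)
  refine squeeze_zero (fun n => (hpos n).le) (fun n => ?_) hlim
  have hq := q_pos ha hN hx (n + 1)
  have := pow_le_q_sq ha hN hx (n + 1)
  rw [div_pow, div_le_iff₀ (by positivity), mul_div_assoc', div_mul_eq_mul_div,
    le_div_iff₀ (by positivity)]
  calc (N : ℝ) ^ (n + 1) * (N + 1) ^ (n + 1)
      ≤ (N : ℝ) ^ (n + 1) * ((N + 1) * (q a₁ a₂ N x (n + 1) : ℝ) ^ 2) := by gcongr
    _ = _ := by ring

/-- By Lebesgue's density theorem, the complement of an invariant set that meets both intervals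
in positive measure is null. -/
lemma volume_OmegaIrr_inter_compl (ha : a₁ < a₂) (hN : IsSimple a₁ a₂ N) {B : Set ℝ}
    (hB : MeasurableSet B) (hTB : T a₁ a₂ N ⁻¹' B = B)
    (h1 : volume (E a₁ ∩ B) ≠ 0) (h2 : volume (E a₂ ∩ B) ≠ 0) :
    volume (OmegaIrr a₁ a₂ ∩ Bᶜ) = 0 := by
  have hN0 : (0 : ℝ) < N := by exact_mod_cast hN.1
  obtain ⟨k, hk0, hk1, hk2⟩ : ∃ k : ℝ, 0 < k ∧ ENNReal.ofReal k ≤ volume (E a₁ ∩ B) ∧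
      ENNReal.ofReal k ≤ volume (E a₂ ∩ B) := by
    have hfin : min (volume (E a₁ ∩ B)) (volume (E a₂ ∩ B)) ≠ ⊤ :=
      ((min_le_left _ _).trans_lt ((measure_mono Set.inter_subset_left).trans_lt
        (by rw [volume_E]; exact ENNReal.one_lt_top))).ne
    have hpos : min (volume (E a₁ ∩ B)) (volume (E a₂ ∩ B)) ≠ 0 :=
      (lt_min (pos_iff_ne_zero.2 h1) (pos_iff_ne_zero.2 h2)).ne'
    refine ⟨_, ENNReal.toReal_pos hpos hfin, ?_, ?_⟩ <;> rw [ENNReal.ofReal_toReal hfin]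
    · exact min_le_left _ _
    · exact min_le_right _ _
  have hdens := IsUnifLocDoublingMeasure.ae_tendsto_measure_inter_div (volume : Measure ℝ) Bᶜ 1
  have hnot : ∀ᵐ x ∂(volume.restrict Bᶜ), x ∉ OmegaIrr a₁ a₂ := by
    filter_upwards [hdens] with x hx hxΩ
    have hδ := tendsto_radius ha hN hxΩ
    have hlim := hx (fun _ : ℕ => x) _ hδ (by
      filter_upwards [hδ self_mem_nhdsWithin] with n hn
      exact Metric.mem_closedBall_self (by rw [one_mul]; exact (Set.mem_Ioi.1 hn).le))
    have hbound : ∀ᶠ n : ℕ in atTop,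
        volume (Bᶜ ∩ Metric.closedBall x ((N : ℝ) ^ (n + 1) / (q a₁ a₂ N x (n + 1) : ℝ) ^ 2)) /
          volume (Metric.closedBall x ((N : ℝ) ^ (n + 1) / (q a₁ a₂ N x (n + 1) : ℝ) ^ 2))
        ≤ ENNReal.ofReal (1 - k / (N + 1) ^ 2 / 2) := by
      refine Eventually.of_forall fun n => ?_
      have hlow := le_volume_inter_closedBall ha hN hB hTB hk1 hk2 hxΩ n
      have hq := q_pos ha hN hxΩ (n + 1)
      obtain ⟨δ, hδdef⟩ : ∃ δ, δ = (N : ℝ) ^ (n + 1) / (q a₁ a₂ N x (n + 1) : ℝ) ^ 2 := ⟨_, rfl⟩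
      have hδ0 : 0 < δ := by rw [hδdef]; positivity
      rw [← hδdef] at hlow ⊢
      have hvol : volume (Metric.closedBall x δ) = ENNReal.ofReal (2 * δ) :=
        Real.volume_closedBall ..
      have hsplit := measure_inter_add_sdiff (μ := volume) (Metric.closedBall x δ) hB
      rw [Set.sdiff_eq, Set.inter_comm _ Bᶜ, Set.inter_comm _ B, hvol] at hsplit
      rw [← ENNReal.ofReal_mul (by positivity)] at hlow
      rw [hvol]
      refine ENNReal.div_le_of_le_mul ?_
      have hle : ENNReal.ofReal (δ / (N + 1) ^ 2 * k) +
          volume (Bᶜ ∩ Metric.closedBall x δ) ≤ ENNReal.ofReal (2 * δ) := by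
        rw [← hsplit]; gcongr
      have := ENNReal.le_sub_of_add_le_left ENNReal.ofReal_ne_top hle
      rw [← ENNReal.ofReal_sub _ (by positivity)] at this
      refine this.trans (le_of_eq ?_)
      rw [← ENNReal.ofReal_mul' (by positivity)]
      congr 1
      field_simp
    have hcon := le_of_tendsto hlim hbound
    rw [← ENNReal.ofReal_one, ENNReal.ofReal_le_ofReal_iff'] at hcon
    have hk' : 0 < k / ((N : ℝ) + 1) ^ 2 / 2 := by positivity
    rcases hcon with hcon | hcon <;> linarith
  rw [ae_iff, Measure.restrict_apply' hB.compl] at hnot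
  simpa using hnot

/-- An invariant set that misses one of the two intervals misses its preimage, which is the
other interval. -/
lemma IsBranch.volume_eq_zero (ha : a₁ < a₂) (hN : IsSimple a₁ a₂ N)
    (h : IsBranch a₁ a₂ N a b) (h' : IsBranch a₁ a₂ N b a) {B : Set ℝ}
    (hB : MeasurableSet B) (hTB : T a₁ a₂ N ⁻¹' B = B) (hb : volume (E b ∩ B) = 0) :
    volume (E a ∩ B) = 0 := by
  have hmp := measurePreserving_T ha hN
  have h1 : invMeasure a₁ a₂ N (E b ∩ B) = 0 :=
    (invMeasure_eq_zero_iff ha hN.1 (measurableSet_E.inter hB)).2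
      (measure_mono_null Set.inter_subset_right hb)
  rw [← hmp.measure_preimage (measurableSet_E.inter hB).nullMeasurableSet] at h1
  have hsub : E a ∩ B ⊆ T a₁ a₂ N ⁻¹' (E b ∩ B) := fun x hx =>
    ⟨h.T_mem hx.1, by rw [← Set.mem_preimage, hTB]; exact hx.2⟩
  have h2 := measure_mono_null hsub h1
  rw [invMeasure_eq_zero_iff ha hN.1 (measurableSet_E.inter hB)] at h2
  have hsub' : E a ∩ B ⊆ OmegaIrr a₁ a₂ ∩ (E a ∩ B) := fun x hx =>
    ⟨h'.mem_OmegaIrr _ hx.1, hx⟩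
  exact measure_mono_null hsub' h2

theorem ergodic_T (ha : a₁ < a₂) (hN : IsSimple a₁ a₂ N) :
    Ergodic (T a₁ a₂ N) (invMeasure a₁ a₂ N) := by
  refine ⟨measurePreserving_T ha hN, ⟨fun B hB hTB => ?_⟩⟩
  have hl := isBranch_left hN
  have hr := isBranch_right ha hN
  have hnull : volume (E a₁ ∩ B) = 0 → volume (E a₂ ∩ B) = 0 →
      EventuallyConst B (ae (invMeasure a₁ a₂ N)) := fun h1 h2 => by
    refine eventuallyConst_set.2 (Or.inr ?_)
    refine measure_eq_zero_iff_ae_notMem.1 ((invMeasure_eq_zero_iff ha hN.1 hB).2 ?_)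
    rw [OmegaIrr, Set.union_inter_distrib_right]
    exact measure_union_null h1 h2
  by_cases h1 : volume (E a₁ ∩ B) = 0
  · exact hnull h1 (hr.volume_eq_zero ha hN hl hB hTB h1)
  by_cases h2 : volume (E a₂ ∩ B) = 0
  · exact hnull (hl.volume_eq_zero ha hN hr hB hTB h2) h2
  refine eventuallyConst_set.2 (Or.inl ?_)
  have := volume_OmegaIrr_inter_compl ha hN hB hTB h1 h2
  rw [← invMeasure_eq_zero_iff ha hN.1 hB.compl] at this
  exact this

/-! ### The distribution of the approximation coefficients -/

lemma muBar_thetaFun_le (c : ℝ) :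
    (muBar a₁ a₂ N).real {z | thetaFun N z ≤ c} = F a₁ a₂ N c := by
  have hX : ∀ᵐ z ∂(muBar a₁ a₂ N), z ∈ X a₁ a₂ :=
    (withDensity_absolutelyContinuous _ _).ae_le (ae_restrict_mem measurableSet_X)
  rw [F, measureReal_def]
  congr 1
  refine measure_congr ?_
  filter_upwards [hX] with z hz
  exact propext ⟨fun h => ⟨hz, h⟩, fun h => h.2⟩

lemma muBar_thetaFun_eq (ha : a₁ < a₂) (hN : IsSimple a₁ a₂ N) (c : ℝ) :
    muBar a₁ a₂ N {z | thetaFun N z = c} = 0 := by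
  have hN0 : (0 : ℝ) < N := by exact_mod_cast hN.1
  have hm : MeasurableSet {z : ℝ × ℝ | thetaFun N z = c} :=
    measurableSet_eq_fun measurable_thetaFun measurable_const
  rw [muBar_eq]
  refine withDensity_absolutelyContinuous _ _ ?_
  rw [Measure.restrict_apply hm, Measure.volume_eq_prod,
    Measure.measure_prod_null (hm.inter measurableSet_G)]
  refine ae_of_all _ fun x => Set.Subsingleton.measure_zero ?_ _
  rintro y ⟨hy, hyG⟩ y' ⟨hy', hyG'⟩
  obtain ⟨a, b, -, -, h1, h2⟩ := exists_isBranch_of_mem_G ha hN hyG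
  obtain ⟨_, _, -, -, -, h2'⟩ := exists_isBranch_of_mem_G ha hN hyG'
  have hx := E.pos h1
  have hy0 := E.pos h2
  have hy0' := E.pos h2'
  simp only at hx hy0 hy0'
  have e1 : N * x / (N + x * y) = c := hy
  have e2 : N * x / (N + x * y') = c := hy'
  rw [← e2, div_eq_div_iff (by positivity) (by positivity)] at e1
  have e3 := mul_left_cancel₀ (by positivity) e1
  exact (mul_left_cancel₀ hx.ne' (add_left_cancel e3)).symm

/-- `F` is the distribution function of `N x / (N + x y)` under `μ̄`, which has no atoms. -/
lemma continuous_F (ha : a₁ < a₂) (hN : IsSimple a₁ a₂ N) : Continuous (F a₁ a₂ N) := by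
  have hprob := isProbabilityMeasure_muBar ha hN.1
  set ν := (muBar a₁ a₂ N).map (thetaFun N) with hν
  have hprobν : IsProbabilityMeasure ν :=
    Measure.isProbabilityMeasure_map measurable_thetaFun.aemeasurable
  have hF : F a₁ a₂ N = ProbabilityTheory.cdf ν := by
    ext c
    rw [ProbabilityTheory.cdf_eq_real, hν, measureReal_def,
      Measure.map_apply measurable_thetaFun measurableSet_Iic, ← muBar_thetaFun_le]
    rfl
  rw [hF, continuous_iff_continuousAt]
  intro c
  rw [(ProbabilityTheory.cdf ν).mono.continuousAt_iff_leftLim_eq_rightLim,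
    StieltjesFunction.rightLim_eq]
  have h0 : (ProbabilityTheory.cdf ν).measure {c} = 0 := by
    rw [ProbabilityTheory.measure_cdf, hν,
      Measure.map_apply measurable_thetaFun (measurableSet_singleton c)]
    exact muBar_thetaFun_eq ha hN c
  rw [StieltjesFunction.measure_singleton, ENNReal.ofReal_eq_zero] at h0
  exact le_antisymm ((ProbabilityTheory.cdf ν).mono.leftLim_le le_rfl) (by linarith)

lemma monotone_F (ha : a₁ < a₂) (hN : 0 < N) : Monotone (F a₁ a₂ N) := by
  intro c c' h
  have := isProbabilityMeasure_muBar ha hN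
  rw [← muBar_thetaFun_le, ← muBar_thetaFun_le]
  exact measureReal_mono fun z (hz : thetaFun N z ≤ c) => hz.trans h

/-- The value after `2 m` steps of the natural extension, started at second coordinate `0`. It
depends on `x` only, and approximates the value started anywhere else. -/
def thetaApprox (a₁ a₂ N m : ℕ) (x : ℝ) : ℝ := thetaFun N ((natExt a₁ a₂ N)^[2 * m] (x, 0))

/-- The error made in replacing the past of an orbit by `0` after `2 m` steps. -/
def approxError (N m : ℕ) : ℝ := N * (((N : ℝ) / (N + 1)) ^ (2 * m) * N)

lemma measurable_thetaApprox {m : ℕ} : Measurable (thetaApprox a₁ a₂ N m) :=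
  measurable_thetaFun.comp
    ((measurable_natExt.iterate (2 * m)).comp (measurable_id.prodMk measurable_const))

lemma tendsto_approxError : Tendsto (approxError N) atTop (𝓝 0) := by
  have h1 : (N : ℝ) / (N + 1) < 1 := by rw [div_lt_one (by positivity)]; linarith
  have h := (tendsto_pow_atTop_nhds_zero_of_lt_one (r := ((N : ℝ) / (N + 1)) ^ 2) (by positivity)
    (pow_lt_one₀ (by positivity) h1 two_ne_zero)).mul_const (N : ℝ)
  have h' := h.const_mul (N : ℝ)
  rw [zero_mul, mul_zero] at h'
  exact h'.congr fun m => by rw [approxError, pow_mul]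

lemma abs_thetaFun_iterate_sub_le (ha : a₁ < a₂) (hN : IsSimple a₁ a₂ N)
    (hx : z.1 ∈ OmegaIrr a₁ a₂) (hy : z.2 ∈ Set.Icc (0 : ℝ) N) (m : ℕ) :
    |thetaFun N ((natExt a₁ a₂ N)^[2 * m] z) - thetaApprox a₁ a₂ N m z.1| ≤ approxError N m := by
  have h0 : (0 : ℝ) ∈ Set.Icc (0 : ℝ) N := ⟨le_rfl, N.cast_nonneg⟩
  have hsnd := abs_snd_iterate_natExt_sub_le ha hN hx hy h0 m
  have hA := snd_iterate_natExt_mem ha hN (z := z) hx hy (2 * m)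
  have hB := snd_iterate_natExt_mem ha hN (z := (z.1, 0)) hx h0 (2 * m)
  have hx' := iterate_T_mem_OmegaIrr ha hN hx (2 * m)
  have e1 : (natExt a₁ a₂ N)^[2 * m] z =
      ((T a₁ a₂ N)^[2 * m] z.1, ((natExt a₁ a₂ N)^[2 * m] z).2) :=
    Prod.ext (fst_iterate_natExt _ _) rfl
  have e2 : (natExt a₁ a₂ N)^[2 * m] (z.1, 0) =
      ((T a₁ a₂ N)^[2 * m] z.1, ((natExt a₁ a₂ N)^[2 * m] (z.1, 0)).2) :=
    Prod.ext (fst_iterate_natExt _ _) rfl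
  rw [thetaApprox, e1, e2]
  refine (abs_thetaFun_sub_le ha hN hx' hA.1 hB.1).trans ?_
  rw [approxError]
  gcongr

lemma abs_theta_sub_le (ha : a₁ < a₂) (hN : IsSimple a₁ a₂ N) (hx : x ∈ OmegaIrr a₁ a₂)
    {m : ℕ} (hm : 1 ≤ m) (j : ℕ) :
    |theta a₁ a₂ N (j + 2 * m) x - thetaApprox a₁ a₂ N m ((T a₁ a₂ N)^[j] x)|
      ≤ approxError N m := by
  have h0 : (0 : ℝ) ∈ Set.Icc (0 : ℝ) N := ⟨le_rfl, N.cast_nonneg⟩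
  have hθ := theta_eq ha hN hx (j + 2 * m - 1)
  rw [show j + 2 * m - 1 + 1 = 2 * m + j by omega, Function.iterate_add_apply] at hθ
  have hfst := fst_iterate_natExt (a₁ := a₁) (a₂ := a₂) (N := N) j (x, 0)
  have h := abs_thetaFun_iterate_sub_le ha hN (z := (natExt a₁ a₂ N)^[j] (x, 0))
    (by rw [hfst]; exact iterate_T_mem_OmegaIrr ha hN hx j)
    (snd_iterate_natExt_mem ha hN (z := (x, 0)) hx h0 j) m
  rwa [hfst, ← hθ, add_comm (2 * m)] at h

lemma ae_muBar_abs_sub_le (ha : a₁ < a₂) (hN : IsSimple a₁ a₂ N) (m : ℕ) :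
    ∀ᵐ z ∂(muBar a₁ a₂ N), |thetaFun N ((natExt a₁ a₂ N)^[2 * m] z) - thetaApprox a₁ a₂ N m z.1|
      ≤ approxError N m := by
  have hG : ∀ᵐ z ∂(muBar a₁ a₂ N), z ∈ G a₁ a₂ := by
    rw [muBar_eq]
    exact (withDensity_absolutelyContinuous _ _).ae_le (ae_restrict_mem measurableSet_G)
  filter_upwards [hG] with z hz
  obtain ⟨a, b, h, h', h1, h2⟩ := exists_isBranch_of_mem_G ha hN hz
  exact abs_thetaFun_iterate_sub_le ha hN (h'.mem_OmegaIrr _ h1)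
    ⟨(E.pos h2).le, (h'.lt_N h2).le⟩ m

lemma invMeasure_real_thetaApprox_le (r : ℝ) (m : ℕ) :
    (invMeasure a₁ a₂ N).real {x | thetaApprox a₁ a₂ N m x ≤ r}
      = (muBar a₁ a₂ N).real {z | thetaApprox a₁ a₂ N m z.1 ≤ r} := by
  rw [invMeasure, map_measureReal_apply measurable_fst
    (measurableSet_le measurable_thetaApprox measurable_const)]
  rfl

lemma muBar_real_thetaFun_iterate (ha : a₁ < a₂) (hN : IsSimple a₁ a₂ N) (r : ℝ) (k : ℕ) :
    (muBar a₁ a₂ N).real {z | thetaFun N ((natExt a₁ a₂ N)^[k] z) ≤ r} = F a₁ a₂ N r := by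
  rw [← muBar_thetaFun_le, measureReal_def, measureReal_def,
    ← ((measurePreserving_natExt ha hN).iterate k).measure_preimage
      measurableSet_thetaFun_le.nullMeasurableSet]
  rfl

lemma invMeasure_thetaApprox_le (ha : a₁ < a₂) (hN : IsSimple a₁ a₂ N) (r : ℝ) (m : ℕ) :
    (invMeasure a₁ a₂ N).real {x | thetaApprox a₁ a₂ N m x ≤ r}
      ≤ F a₁ a₂ N (r + approxError N m) := by
  have := isProbabilityMeasure_muBar ha hN.1
  rw [invMeasure_real_thetaApprox_le, ← muBar_real_thetaFun_iterate ha hN _ (2 * m)]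
  refine ENNReal.toReal_mono (measure_ne_top _ _) (measure_mono_ae ?_)
  filter_upwards [ae_muBar_abs_sub_le ha hN m] with z hz (hzr : thetaApprox a₁ a₂ N m z.1 ≤ r)
  have := (abs_le.1 hz).2
  exact (by linarith : thetaFun N ((natExt a₁ a₂ N)^[2 * m] z) ≤ r + approxError N m)

lemma le_invMeasure_thetaApprox (ha : a₁ < a₂) (hN : IsSimple a₁ a₂ N) (r : ℝ) (m : ℕ) :
    F a₁ a₂ N (r - approxError N m)
      ≤ (invMeasure a₁ a₂ N).real {x | thetaApprox a₁ a₂ N m x ≤ r} := by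
  have := isProbabilityMeasure_muBar ha hN.1
  rw [invMeasure_real_thetaApprox_le, ← muBar_real_thetaFun_iterate ha hN _ (2 * m)]
  refine ENNReal.toReal_mono (measure_ne_top _ _) (measure_mono_ae ?_)
  filter_upwards [ae_muBar_abs_sub_le ha hN m] with z hz
    (hzr : thetaFun N ((natExt a₁ a₂ N)^[2 * m] z) ≤ r - approxError N m)
  have := (abs_le.1 hz).1
  exact (by linarith : thetaApprox a₁ a₂ N m z.1 ≤ r)

open Classical in
/-- The number of `j < n` for which the approximate coefficient of `T^j x` is at most `r`. -/
def approxCount (a₁ a₂ N m : ℕ) (r x : ℝ) (n : ℕ) : ℕ :=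
  ((Finset.range n).filter fun j => thetaApprox a₁ a₂ N m ((T a₁ a₂ N)^[j] x) ≤ r).card

lemma count_le (ha : a₁ < a₂) (hN : IsSimple a₁ a₂ N) (hx : x ∈ OmegaIrr a₁ a₂) {m : ℕ}
    (hm : 1 ≤ m) {r : ℝ} (hr : c + approxError N m ≤ r) (n : ℕ) :
    count a₁ a₂ N x c n ≤ approxCount a₁ a₂ N m r x n + 2 * m := by
  classical
  have hsub : ((Finset.Icc 1 n).filter fun i => theta a₁ a₂ N i x ≤ c) ⊆
      ((Finset.range n).filter fun j => thetaApprox a₁ a₂ N m ((T a₁ a₂ N)^[j] x) ≤ r).image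
        (· + 2 * m) ∪ Finset.Icc 1 (2 * m) := by
    intro i hi
    rw [Finset.mem_filter, Finset.mem_Icc] at hi
    rw [Finset.mem_union, Finset.mem_image, Finset.mem_Icc]
    -- The first `2 m` coefficients are not controlled; the others are compared after a shift.
    rcases le_or_gt i (2 * m) with h | h
    · exact Or.inr ⟨hi.1.1, h⟩
    · refine Or.inl ⟨i - 2 * m, ?_, by omega⟩
      rw [Finset.mem_filter, Finset.mem_range]
      refine ⟨by omega, ?_⟩
      have := abs_theta_sub_le ha hN hx hm (i - 2 * m)
      rw [Nat.sub_add_cancel h.le] at this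
      linarith [(abs_le.1 this).1, hi.2]
  have h1 := (Finset.card_le_card hsub).trans (Finset.card_union_le _ _)
  rw [Finset.card_image_of_injective _ (add_left_injective _), Nat.card_Icc,
    Nat.add_sub_cancel] at h1
  unfold count approxCount
  convert h1

lemma approxCount_le (ha : a₁ < a₂) (hN : IsSimple a₁ a₂ N) (hx : x ∈ OmegaIrr a₁ a₂) {m : ℕ}
    (hm : 1 ≤ m) {r : ℝ} (hr : r + approxError N m ≤ c) (n : ℕ) :
    approxCount a₁ a₂ N m r x n ≤ count a₁ a₂ N x c n + 2 * m := by
  classical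
  have hsub : ((Finset.range n).filter
      fun j => thetaApprox a₁ a₂ N m ((T a₁ a₂ N)^[j] x) ≤ r).image (· + 2 * m) ⊆
        ((Finset.Icc 1 n).filter fun i => theta a₁ a₂ N i x ≤ c) ∪
          Finset.Ioc n (n + 2 * m) := by
    intro i hi
    rw [Finset.mem_image] at hi
    obtain ⟨j, hj, rfl⟩ := hi
    rw [Finset.mem_filter, Finset.mem_range] at hj
    rw [Finset.mem_union, Finset.mem_filter, Finset.mem_Icc, Finset.mem_Ioc]
    rcases le_or_gt (j + 2 * m) n with h | h
    · refine Or.inl ⟨⟨by omega, h⟩, ?_⟩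
      have := abs_theta_sub_le ha hN hx hm j
      linarith [(abs_le.1 this).2, hj.2]
    · exact Or.inr ⟨h, by omega⟩
  have h1 := (Finset.card_le_card hsub).trans (Finset.card_union_le _ _)
  rw [Finset.card_image_of_injective _ (add_left_injective _), Nat.card_Ioc,
    Nat.add_sub_cancel_left] at h1
  unfold count approxCount
  convert h1

lemma ae_tendsto_approxCount (ha : a₁ < a₂) (hN : IsSimple a₁ a₂ N) (m : ℕ) (r : ℝ) :
    ∀ᵐ x ∂(invMeasure a₁ a₂ N), Tendsto (fun n : ℕ => (approxCount a₁ a₂ N m r x n : ℝ) / n) atTop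
      (𝓝 ((invMeasure a₁ a₂ N).real {x | thetaApprox a₁ a₂ N m x ≤ r})) := by
  classical
  have := isProbabilityMeasure_invMeasure ha hN.1
  have hm : MeasurableSet {x | thetaApprox a₁ a₂ N m x ≤ r} :=
    measurableSet_le measurable_thetaApprox measurable_const
  have hb := Ergodic.ae_tendsto_birkhoffAverage (ergodic_T ha hN)
    (f := {x | thetaApprox a₁ a₂ N m x ≤ r}.indicator fun _ => (1 : ℝ))
    (measurable_const.indicator hm) ((integrable_const _).indicator hm)
  filter_upwards [hb] with x hx
  rw [integral_indicator_const _ hm, smul_eq_mul, mul_one] at hx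
  refine hx.congr fun n => ?_
  rw [birkhoffAverage, birkhoffSum, smul_eq_mul, inv_mul_eq_div, approxCount,
    Finset.card_filter]
  push_cast
  congr 1

lemma restrict_Omega_eq : (volume : Measure ℝ).restrict (Omega a₁ a₂)
    = volume.restrict (OmegaIrr a₁ a₂) := by
  refine Measure.restrict_congr_set ?_
  filter_upwards [ae_irrational] with x hx
  refine propext ⟨fun h => ?_, fun h => ?_⟩
  · exact h.imp (fun h => mem_E_of_irrational hx ⟨h.1, h.2.le⟩)
      (fun h => mem_E_of_irrational hx ⟨h.1, h.2.le⟩)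
  · exact h.imp (fun h => E_subset_I h) (fun h => E_subset_I h)

lemma restrict_Omega_absolutelyContinuous (ha : a₁ < a₂) (hN : 0 < N) :
    (volume : Measure ℝ).restrict (Omega a₁ a₂) ≪ invMeasure a₁ a₂ N := by
  rw [restrict_Omega_eq]
  refine Measure.AbsolutelyContinuous.mk fun s hs h => ?_
  rw [Measure.restrict_apply hs, Set.inter_comm]
  exact (invMeasure_eq_zero_iff ha hN hs).1 h

/-- The frequencies of `θᵢ ≤ c` are squeezed, for each `m`, between frequencies of sublevel sets of
`thetaApprox m` at rational levels near `c`, to which the pointwise ergodic theorem applies. -/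
theorem ae_tendsto_count (ha : a₁ < a₂) (hN : IsSimple a₁ a₂ N) :
    ∀ᵐ x ∂(volume.restrict (Omega a₁ a₂)), ∀ c : ℝ,
      Tendsto (fun n : ℕ => (count a₁ a₂ N x c n : ℝ) / n) atTop (𝓝 (F a₁ a₂ N c)) := by
  have hΩ : ∀ᵐ x ∂(volume.restrict (Omega a₁ a₂)), x ∈ OmegaIrr a₁ a₂ := by
    rw [restrict_Omega_eq]
    exact ae_restrict_mem measurableSet_OmegaIrr
  have hB : ∀ᵐ x ∂(volume.restrict (Omega a₁ a₂)), ∀ (m : ℕ) (r : ℚ),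
      Tendsto (fun n : ℕ => (approxCount a₁ a₂ N m r x n : ℝ) / n) atTop
        (𝓝 ((invMeasure a₁ a₂ N).real {x | thetaApprox a₁ a₂ N m x ≤ r})) :=
    (restrict_Omega_absolutelyContinuous ha hN.1).ae_le
      (ae_all_iff.2 fun m => ae_all_iff.2 fun r => ae_tendsto_approxCount ha hN m r)
  filter_upwards [hΩ, hB] with x hx hxB c
  have hcont : Tendsto (F a₁ a₂ N) (𝓝 c) (𝓝 (F a₁ a₂ N c)) := (continuous_F ha hN).tendsto c
  have hF := monotone_F ha hN.1
  have hm0 : ∀ m : ℕ, Tendsto (fun n : ℕ => ((2 * m : ℕ) : ℝ) / n) atTop (𝓝 0) := fun m =>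
    tendsto_const_div_atTop_nhds_zero_nat _
  refine tendsto_order.2 ⟨fun s hs => ?_, fun s hs => ?_⟩
  · obtain ⟨c', hc', hsc'⟩ : ∃ c' < c, s < F a₁ a₂ N c' :=
      ((eventually_mem_nhdsWithin (a := c) (s := Set.Iio c)).and
        ((hcont.eventually (lt_mem_nhds hs)).filter_mono nhdsWithin_le_nhds)).exists
    obtain ⟨r, hr1, hr2⟩ := exists_rat_btwn hc'
    obtain ⟨m, hm, hm1, hm2⟩ := ((eventually_ge_atTop 1).and
      ((tendsto_approxError (N := N).eventually (gt_mem_nhds (sub_pos.2 hr1))).and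
        (tendsto_approxError (N := N).eventually (gt_mem_nhds (sub_pos.2 hr2))))).exists
    have hlim := (hxB m r).sub (hm0 m)
    rw [sub_zero] at hlim
    have hslt : s < (invMeasure a₁ a₂ N).real {x | thetaApprox a₁ a₂ N m x ≤ r} :=
      (hsc'.trans_le (hF (by linarith))).trans_le (le_invMeasure_thetaApprox ha hN r m)
    filter_upwards [hlim.eventually (lt_mem_nhds hslt)] with n hn
    refine hn.trans_le ?_
    rw [← sub_div]
    have := approxCount_le ha hN hx hm (c := c) (r := r) (by linarith) n
    have : (approxCount a₁ a₂ N m r x n : ℝ) ≤ count a₁ a₂ N x c n + (2 * m : ℕ) := by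
      exact_mod_cast this
    gcongr
    linarith
  · obtain ⟨c', hc', hsc'⟩ : ∃ c' > c, F a₁ a₂ N c' < s :=
      ((eventually_mem_nhdsWithin (a := c) (s := Set.Ioi c)).and
        ((hcont.eventually (gt_mem_nhds hs)).filter_mono nhdsWithin_le_nhds)).exists
    obtain ⟨r, hr1, hr2⟩ := exists_rat_btwn hc'
    obtain ⟨m, hm, hm1, hm2⟩ := ((eventually_ge_atTop 1).and
      ((tendsto_approxError (N := N).eventually (gt_mem_nhds (sub_pos.2 hr1))).and
        (tendsto_approxError (N := N).eventually (gt_mem_nhds (sub_pos.2 hr2))))).exists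
    have hlim := (hxB m r).add (hm0 m)
    rw [add_zero] at hlim
    have hlts : (invMeasure a₁ a₂ N).real {x | thetaApprox a₁ a₂ N m x ≤ r} < s :=
      ((invMeasure_thetaApprox_le ha hN r m).trans (hF (by linarith))).trans_lt hsc'
    filter_upwards [hlim.eventually (gt_mem_nhds hlts)] with n hn
    refine lt_of_le_of_lt ?_ hn
    rw [← add_div]
    have := count_le ha hN hx hm (c := c) (r := r) (by linarith) n
    have : (count a₁ a₂ N x c n : ℝ) ≤ approxCount a₁ a₂ N m r x n + (2 * m : ℕ) := by
      exact_mod_cast this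
    gcongr

/-! ### The distribution function, piece by piece -/

/-- Both end points of `[a, a+1)` divide `N`, and they are coprime. -/
lemma IsBranch.self_mul_succ_le (h : IsBranch a₁ a₂ N a b) : (a : ℝ) * (a + 1) ≤ N := by
  rcases Nat.eq_zero_or_pos a with ha | ha
  · simp [ha]
  · have hdvd : a * (a + 1) ∣ N :=
      Nat.Coprime.mul_dvd_of_dvd_of_dvd (by simp) (h.dvd ha.ne') h.dvd_succ
    exact_mod_cast Nat.le_of_dvd h.pos hdvd

lemma mul_div_add_mul_le {M x x' y y' : ℝ} (hM : 0 < M) (hx : 0 ≤ x) (hxx' : x ≤ x')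
    (hy' : 0 ≤ y') (hyy' : y' ≤ y) : M * x / (M + x * y) ≤ M * x' / (M + x' * y') := by
  have hx' := hx.trans hxx'
  have hy := hy'.trans hyy'
  rw [div_le_div_iff₀ (by positivity) (by positivity)]
  have h1 : M * M * x ≤ M * M * x' := by gcongr
  have h2 : M * (x * x') * y' ≤ M * (x * x') * y := by gcongr
  linarith

/-- The second rectangle contributes nothing before its lowest threshold. -/
lemma F_eq_left (ha : a₁ < a₂) (hN : 0 < N) (hc : c ≤ N * a₂ / (N + a₂ * (a₁ + 1))) :
    F a₁ a₂ N c = C a₁ a₂ N * stripMass N a₁ a₂ c := by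
  rw [F_eq ha hN, stripMass_of_le (a := a₂) hN hc, add_zero]

/-- The first rectangle contributes half of the mass from its highest threshold on. -/
lemma F_eq_right (ha : a₁ < a₂) (hN : 0 < N)
    (hc : (N : ℝ) * (a₁ + 1) / (N + a₂ * (a₁ + 1)) ≤ c) :
    F a₁ a₂ N c = 1 / 2 + C a₁ a₂ N * stripMass N a₂ a₁ c := by
  rw [F_eq ha hN, stripMass_of_ge (a := a₁) hN hc, mul_add, C_mul_fullMass ha hN]

end AltNCF

end

open AltNCF in
theorem mainTheorem5 (a₁ a₂ N : ℕ) (ha : a₁ < a₂) (hN : AltNCF.IsSimple a₁ a₂ N) :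
    -- the normalised measure and its constant
    IsProbabilityMeasure (AltNCF.muBar a₁ a₂ N) ∧
    (AltNCF.C a₁ a₂ N)⁻¹ =
      2 * Real.log (1 + (N : ℝ) / (((N : ℝ) + a₁ * (a₂ + 1)) * ((N : ℝ) + a₂ * (a₁ + 1)))) ∧
    -- the distribution of the approximation coefficients of almost every point
    (∀ᵐ x ∂(volume.restrict (AltNCF.Omega a₁ a₂)), ∀ c : ℝ,
      Tendsto (fun n : ℕ => (AltNCF.count a₁ a₂ N x c n : ℝ) / n) atTop
        (𝓝 (AltNCF.F a₁ a₂ N c))) ∧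
    -- the distribution function, piece by piece
    (∀ c ∈ Set.Iic ((N : ℝ) * a₁ / (N + a₁ * (a₂ + 1))),
      AltNCF.F a₁ a₂ N c = 0) ∧
    (∀ c ∈ Set.Ioc ((N : ℝ) * a₁ / (N + a₁ * (a₂ + 1))) ((N : ℝ) * a₁ / (N + a₁ * a₂)),
      AltNCF.F a₁ a₂ N c = AltNCF.C a₁ a₂ N *
        (c * (a₂ + 1 + (N : ℝ) / a₁) / N - 1
          - Real.log ((N * c + c * a₁ * (a₂ + 1)) / (a₁ * N)))) ∧
    (∀ c ∈ Set.Ioc ((N : ℝ) * a₁ / (N + a₁ * a₂))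
        ((N : ℝ) * (a₁ + 1) / (N + (a₁ + 1) * (a₂ + 1))),
      AltNCF.F a₁ a₂ N c = AltNCF.C a₁ a₂ N *
        (-Real.log (((N : ℝ) + a₁ * (a₂ + 1)) / (N + a₁ * a₂)) + c / N)) ∧
    (∀ c ∈ Set.Ioc ((N : ℝ) * (a₁ + 1) / (N + (a₁ + 1) * (a₂ + 1)))
        ((N : ℝ) * (a₁ + 1) / (N + a₂ * (a₁ + 1))),
      AltNCF.F a₁ a₂ N c = AltNCF.C a₁ a₂ N *
        (Real.log ((N * c + c * (a₁ + 1) * (a₂ + 1)) / (N * (a₁ + 1))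
            * (((N : ℝ) + a₁ * a₂) / (N + a₁ * (a₂ + 1))))
          + 1 - c / (a₁ + 1) - c * a₂ / N)) ∧
    (∀ c ∈ Set.Ioc ((N : ℝ) * (a₁ + 1) / (N + a₂ * (a₁ + 1)))
        ((N : ℝ) * a₂ / (N + a₂ * (a₁ + 1))),
      AltNCF.F a₁ a₂ N c = 1 / 2) ∧
    (∀ c ∈ Set.Ioc ((N : ℝ) * a₂ / (N + a₂ * (a₁ + 1))) ((N : ℝ) * a₂ / (N + a₁ * a₂)),
      AltNCF.F a₁ a₂ N c = 1 / 2 + AltNCF.C a₁ a₂ N *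
        (c * (a₁ + 1 + (N : ℝ) / a₂) / N - 1
          - Real.log ((N * c + c * a₂ * (a₁ + 1)) / (a₂ * N)))) ∧
    (∀ c ∈ Set.Ioc ((N : ℝ) * a₂ / (N + a₁ * a₂))
        ((N : ℝ) * (a₂ + 1) / (N + (a₁ + 1) * (a₂ + 1))),
      AltNCF.F a₁ a₂ N c = 1 / 2 + AltNCF.C a₁ a₂ N *
        (-Real.log (((N : ℝ) + a₂ * (a₁ + 1)) / (N + a₁ * a₂)) + c / N)) ∧
    (∀ c ∈ Set.Ioc ((N : ℝ) * (a₂ + 1) / (N + (a₁ + 1) * (a₂ + 1)))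
        ((N : ℝ) * (a₂ + 1) / (N + a₁ * (a₂ + 1))),
      AltNCF.F a₁ a₂ N c = 1 / 2 + AltNCF.C a₁ a₂ N *
        (Real.log ((N * c + c * (a₂ + 1) * (a₁ + 1)) / (N * (a₂ + 1))
            * (((N : ℝ) + a₁ * a₂) / (N + a₂ * (a₁ + 1))))
          + 1 - c / (a₂ + 1) - c * a₁ / N)) ∧
    (∀ c ∈ Set.Ioi ((N : ℝ) * (a₂ + 1) / (N + a₁ * (a₂ + 1))),
      AltNCF.F a₁ a₂ N c = 1) := by
  have hN0 : 0 < N := hN.1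
  have hM : (0 : ℝ) < N := by exact_mod_cast hN0
  have h₁ : (0 : ℝ) ≤ a₁ := a₁.cast_nonneg
  have h₂ : (0 : ℝ) ≤ a₂ := a₂.cast_nonneg
  have h₁₂ : (a₁ : ℝ) + 1 ≤ a₂ := by exact_mod_cast ha
  have hsq₁ := (isBranch_left hN).self_mul_succ_le
  have hsq₂ := (isBranch_right ha hN).self_mul_succ_le
  have hmid : (N : ℝ) * (a₁ + 1) / (N + a₂ * (a₁ + 1)) ≤ N * a₂ / (N + a₂ * (a₁ + 1)) := by
    gcongr
  refine ⟨isProbabilityMeasure_muBar ha hN0, ?_, ae_tendsto_count ha hN, fun c hc => ?_,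
    fun c hc => ?_, fun c hc => ?_, fun c hc => ?_, fun c hc => ?_, fun c hc => ?_,
    fun c hc => ?_, fun c hc => ?_, fun c hc => ?_⟩
  · rw [inv_C ha hN0, fullMass_eq_log hN0]
  · rw [F_eq_left ha hN0, stripMass_of_le hN0 hc, mul_zero]
    exact hc.out.trans (mul_div_add_mul_le hM h₁ (by linarith) (by linarith) (by linarith))
  · rw [F_eq_left ha hN0, stripMass_of_mem_first hN0 hsq₁ hc]
    exact hc.2.trans (mul_div_add_mul_le hM h₁ (by linarith) (by linarith) (by linarith))
  · rw [F_eq_left ha hN0, stripMass_of_mem_second hN0 hc]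
    exact hc.2.trans (mul_div_add_mul_le hM (by linarith) (by linarith) (by linarith)
      (by linarith))
  · rw [F_eq_left ha hN0 (hc.2.trans hmid), stripMass_of_mem_third hN0 hsq₁ hc]
  · rw [F_eq_left ha hN0 hc.2, stripMass_of_ge hN0 hc.1.le, C_mul_fullMass ha hN0]
  · rw [mul_comm (a₁ : ℝ) a₂] at hc
    rw [F_eq_right ha hN0 (hmid.trans hc.1.le), stripMass_of_mem_first hN0 hsq₂ hc]
  · rw [mul_comm (a₁ : ℝ) a₂, mul_comm ((a₁ : ℝ) + 1)] at hc
    rw [F_eq_right ha hN0, stripMass_of_mem_second hN0 hc, mul_comm (a₁ : ℝ) a₂]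
    exact hmid.trans ((mul_div_add_mul_le hM h₂ le_rfl h₁ (by linarith)).trans hc.1.le)
  · rw [mul_comm ((a₁ : ℝ) + 1)] at hc
    rw [F_eq_right ha hN0, stripMass_of_mem_third hN0 hsq₂ hc, mul_comm (a₁ : ℝ) a₂]
    exact hmid.trans ((mul_div_add_mul_le hM h₂ (by linarith) (by linarith) le_rfl).trans
      hc.1.le)
  · have hlow : (N : ℝ) * a₂ / (N + a₂ * (a₁ + 1)) ≤ N * (a₂ + 1) / (N + (a₂ + 1) * a₁) :=
      mul_div_add_mul_le hM h₂ (by linarith) h₁ (by linarith)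
    rw [mul_comm ((a₂ : ℝ) + 1) (a₁ : ℝ)] at hlow
    rw [F_eq_right ha hN0 (hmid.trans (hlow.trans hc.out.le)), stripMass_of_ge hN0 hc.out.le,
      fullMass_symm, C_mul_fullMass ha hN0]
    norm_num
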